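/- Let $X$ be a compact complex manifold and let $A^{\bullet}(X)$ be the algebra of smooth complex-valued differential forms on $X$, with exterior derivative $d=\partial+\bar\partial$. Let $\phi\in A^{0,1}(X,T_X^{1,0})$ be an integrable Beltrami differential, i.e. one that satisfies the Maurer–Cartan equation $\bar\partial\phi=\frac12[\phi,\phi]$ (for example a Beltrami differential that represents the complex structure of a small deformation $X_t$ of $X$). Let $i_\phi$ be contraction with $\phi$: if $\phi=\sum_j\phi^j\otimes\frac{\partial}{\partial z_j}$ in local holomorphic coordinates, then $i_\phi\eta=\sum_j\phi^j\wedge(\frac{\partial}{\partial z_j}\lrcorner\,\eta)$. Put $$\mathcal L_\phi^{1,0}=i_\phi\partial-\partial i_\phi,\qquad \bar\partial_\phi=\bar\partial-\mathcal L_\phi^{1,0},\qquad d_\phi=\partial+\bar\partial_\phi .$$ Suppose that $X$ satisfies the $\partial\bar\partial_\phi$-lemma, i.e. that $$\ker\partial\cap\ker\bar\partial_\phi\cap\operatorname{im}d_\phi=\operatorname{im}\partial\bar\partial_\phi\quad\text{on }A^{\bullet}(X).$$ Then $X$ is formal: the de Rham algebra $(A^{\bullet}(X),d)$ is connected with its cohomology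 algebra $(H^{\bullet}_{dR}(X;\mathbb C),0)$ by a finite chain of quasi-isomorphisms (in either direction) of graded-commutative differential graded algebras over $\mathbb C$. -/

import Mathlib

open scoped Manifold ContDiff DirectSum

universe u

noncomputable section

namespace DeformedForms

/-! ### Forms on `ℂⁿ` -/

/-- The model space `ℂⁿ`. -/
abbrev Cn (n : ℕ) := EuclideanSpace ℂ (Fin n)

/-- Complexified covectors: real-linear maps `ℂⁿ → ℂ`. -/
abbrev Cot (n : ℕ) := Cn n →L[ℝ] ℂ

/-- The fibre `Λ^•(T^*⊗ℂ)`: the exterior algebra over `ℂ` of the complexified covectors. -/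
abbrev Lam (n : ℕ) := ExteriorAlgebra ℂ (Cot n)

variable {n : ℕ}

instance addCommGroup_cot : AddCommGroup (Cot n) := inferInstance
instance addCommMonoid_cot : AddCommMonoid (Cot n) := inferInstance
instance module_cot : Module ℂ (Cot n) := inferInstance

instance ring_lam : Ring (Lam n) := inferInstance
instance semiring_lam : Semiring (Lam n) := inferInstance
instance algebra_lam : Algebra ℂ (Lam n) := inferInstance
instance module_lam : Module ℂ (Lam n) := inferInstance
instance addCommGroup_lam : AddCommGroup (Lam n) := inferInstance
instance addCommMonoid_lam : AddCommMonoid (Lam n) := inferInstance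
instance mul_lam : Mul (Lam n) := inferInstance
instance add_lam : Add (Lam n) := inferInstance

/-- The coordinate vector `∂/∂x_j`. -/
abbrev vecE (j : Fin n) : Cn n := EuclideanSpace.single j (1 : ℂ)

/-- The covector `dz_j`. -/
def dz (j : Fin n) : Cot n := (EuclideanSpace.proj j : Cn n →L[ℂ] ℂ).restrictScalars ℝ

/-- The covector `dz̄_j`. -/
def dzbar (j : Fin n) : Cot n := (Complex.conjCLE : ℂ →L[ℝ] ℂ).comp (dz j)

/-- `½ (L(∂/∂x_j) - i L(∂/∂y_j))`, the value of (the complex-linear extension of) a real-linear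
map `L` on the vector `∂/∂z_j`. -/
def evalZ {F : Type*} [AddCommGroup F] [Module ℂ F] (L : Cn n → F) (j : Fin n) : F :=
  (1 / 2 : ℂ) • (L (vecE j) - Complex.I • L (Complex.I • vecE j))

/-- `½ (L(∂/∂x_j) + i L(∂/∂y_j))`, the value of (the complex-linear extension of) a real-linear
map `L` on the vector `∂/∂z̄_j`. -/
def evalZbar {F : Type*} [AddCommGroup F] [Module ℂ F] (L : Cn n → F) (j : Fin n) : F :=
  (1 / 2 : ℂ) • (L (vecE j) + Complex.I • L (Complex.I • vecE j))

@[simp] lemma dz_apply (j : Fin n) (v : Cn n) : dz j v = v j := rfl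
@[simp] lemma dzbar_apply (j : Fin n) (v : Cn n) : dzbar j v = (starRingEnd ℂ) (v j) := rfl

lemma vec_decomp (v : Cn n) :
    v = ∑ j, ((v j).re • vecE j + (v j).im • (Complex.I • vecE j)) := by
  ext k
  simp only [WithLp.ofLp_sum, Finset.sum_apply, PiLp.add_apply, PiLp.smul_apply,
    PiLp.single_apply]
  rw [Finset.sum_eq_single k]
  · simp [Complex.re_add_im]
  · intro j _ h; simp [h.symm]
  · simp

lemma map_decomp {F : Type*} [AddCommGroup F] [Module ℂ F] [Module ℝ F] [IsScalarTower ℝ ℂ F]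
    (L : Cn n →ₗ[ℝ] F) (v : Cn n) :
    L v = ∑ j, (dz j v • evalZ L j + dzbar j v • evalZbar L j) := by
  conv_lhs => rw [vec_decomp v]
  rw [map_sum]
  refine Finset.sum_congr rfl fun j _ => ?_
  rw [map_add, map_smul, map_smul]
  simp only [evalZ, evalZbar, dz_apply, dzbar_apply]
  rw [← algebraMap_smul ℂ (v j).re (L (vecE j)), ← algebraMap_smul ℂ (v j).im (L _)]
  simp only [Complex.coe_algebraMap, smul_sub, smul_add, smul_smul]
  set a : ℝ := (v j).re with ha
  set b : ℝ := (v j).im with hb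
  have h1 : v j = a + b * Complex.I := (Complex.re_add_im _).symm
  have h2 : (starRingEnd ℂ) (v j) = a - b * Complex.I := by
    rw [h1]; simp [sub_eq_add_neg]
  rw [h2, h1]
  match_scalars
  · ring
  · linear_combination (b : ℂ) * Complex.I_mul_I

lemma cot_decomp (α : Cot n) : α = ∑ j, (evalZ α j • dz j + evalZbar α j • dzbar j) := by
  ext v
  have := map_decomp (α : Cn n →ₗ[ℝ] ℂ) v
  simp only [ContinuousLinearMap.coe_coe] at this
  rw [this]
  simp only [FunLike.coe_sum, Finset.sum_apply, add_apply,
    smul_apply, smul_eq_mul]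
  refine Finset.sum_congr rfl fun j _ => ?_
  ring

instance finite_cot : Module.Finite ℂ (Cot n) := by
  classical
  refine ⟨⟨Finset.univ.image dz ∪ Finset.univ.image dzbar, ?_⟩⟩
  rw [eq_top_iff]
  rintro α -
  rw [cot_decomp α]
  refine Submodule.sum_mem _ fun j _ => Submodule.add_mem _ (Submodule.smul_mem _ _ ?_)
    (Submodule.smul_mem _ _ ?_) <;> exact Submodule.subset_span (by simp)

instance finite_lam : Module.Finite ℂ (Lam n) :=
  Module.Finite.of_basis (Module.finBasis ℂ (Cot n)).ExteriorAlgebra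

/-- A norm on the finite-dimensional fibre; any two norms are equivalent, so that smoothness and
derivatives do not depend on the choice. -/
instance normed_lam : NormedAddCommGroup (Lam n) :=
  NormedAddCommGroup.induced (Lam n) (Fin _ → ℂ) (Module.finBasis ℂ (Lam n)).equivFun
    (Module.finBasis ℂ (Lam n)).equivFun.injective

instance normedSpace_lam : NormedSpace ℂ (Lam n) :=
  NormedSpace.induced ℂ (Lam n) (Fin _ → ℂ) (Module.finBasis ℂ (Lam n)).equivFun

instance normedSpaceReal_lam : NormedSpace ℝ (Lam n) := NormedSpace.complexToReal
instance moduleReal_lam : Module ℝ (Lam n) := NormedSpace.toModule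
instance smulReal_lam : SMul ℝ (Lam n) := (moduleReal_lam (n := n)).toSMul
instance scalarTower_lam : IsScalarTower ℝ ℂ (Lam n) := ⟨fun r c x => by
  change ((r : ℂ) * c) • x = (r : ℂ) • c • x; rw [mul_smul]⟩
instance topAddGroup_lam : IsTopologicalAddGroup (Lam n) := inferInstance
instance contSMul_lam : ContinuousSMul ℝ (Lam n) := inferInstance

instance finiteReal_lam : FiniteDimensional ℝ (Lam n) := FiniteDimensional.complexToReal _

/-- The inclusion of covectors into the exterior algebra. -/
abbrev cov (α : Cot n) : Lam n := ExteriorAlgebra.ι ℂ α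

/-- `∑_j dz_j ∧ L(∂/∂z_j)`. -/
def delLin (L : Cn n →L[ℝ] Lam n) : Lam n := ∑ j, cov (dz j) * evalZ L j

/-- `∑_j dz̄_j ∧ L(∂/∂z̄_j)`. -/
def delbarLin (L : Cn n →L[ℝ] Lam n) : Lam n := ∑ j, cov (dzbar j) * evalZbar L j

/-- `∂η = ∑_j dz_j ∧ ∂η/∂z_j` on `ℂⁿ`. -/
def delLoc (η : Cn n → Lam n) (y : Cn n) : Lam n := delLin (fderiv ℝ η y)

/-- `∂̄η = ∑_j dz̄_j ∧ ∂η/∂z̄_j` on `ℂⁿ`. -/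
def delbarLoc (η : Cn n → Lam n) (y : Cn n) : Lam n := delbarLin (fderiv ℝ η y)

/-- `dη = ∂η + ∂̄η` on `ℂⁿ`. -/
def dLoc (η : Cn n → Lam n) (y : Cn n) : Lam n := delLoc η y + delbarLoc η y

/-- The transpose `α ↦ α ∘ A` of a real-linear map on covectors. -/
def cotPull (A : Cn n →L[ℝ] Cn n) : Cot n →ₗ[ℂ] Cot n where
  toFun α := α.comp A
  map_add' _ _ := rfl
  map_smul' _ _ := rfl

/-- The map induced on the exterior algebra by the transpose of `A`. -/
def pull (A : Cn n →L[ℝ] Cn n) : Lam n →ₐ[ℂ] Lam n := ExteriorAlgebra.map (cotPull A)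

/-! ### Algebra of the fibre -/

/-- the real coordinate covectors -/
def dRe (j : Fin n) : Cot n := (1 / 2 : ℂ) • (dz j + dzbar j)
def dIm (j : Fin n) : Cot n := (-Complex.I / 2 : ℂ) • (dz j - dzbar j)

lemma dRe_apply (j : Fin n) (v : Cn n) : dRe j v = (v j).re := by
  have := Complex.add_conj (v j)
  simp only [dRe, smul_apply, add_apply, dz_apply, dzbar_apply, smul_eq_mul, this]
  push_cast; ring
lemma dIm_apply (j : Fin n) (v : Cn n) : dIm j v = (v j).im := by
  have := Complex.sub_conj (v j)
  simp only [dIm, smul_apply, sub_apply, dz_apply, dzbar_apply, smul_eq_mul, this]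
  push_cast; linear_combination -(v j).im * Complex.I_mul_I

/-- `∑ dx_j ∧ L(∂/∂x_j) + dy_j ∧ L(∂/∂y_j)` -/
def dLin (L : Cn n →L[ℝ] Lam n) : Lam n :=
  ∑ j, (cov (dRe j) * L (vecE j) + cov (dIm j) * L (Complex.I • vecE j))

lemma dLin_eq (L : Cn n →L[ℝ] Lam n) : dLin L = delLin L + delbarLin L := by
  simp only [dLin, delLin, delbarLin, ← Finset.sum_add_distrib]
  refine Finset.sum_congr rfl fun j _ => ?_
  simp only [evalZ, evalZbar, dRe, dIm, cov, map_smul, map_add, map_sub, smul_add, smul_sub,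
    mul_add, mul_sub, add_mul, sub_mul, smul_mul_assoc, mul_smul_comm, smul_smul]
  module

lemma dLoc_eq (η : Cn n → Lam n) (y : Cn n) : dLoc η y = dLin (fderiv ℝ η y) := (dLin_eq _).symm

lemma pull_cov (A : Cn n →L[ℝ] Cn n) (α : Cot n) : pull A (cov α) = cov (α.comp A) :=
  ExteriorAlgebra.map_apply_ι _ _

lemma pull_id (x : Lam n) : pull (ContinuousLinearMap.id ℝ _) x = x := by
  have : cotPull (ContinuousLinearMap.id ℝ (Cn n)) = LinearMap.id := rfl
  rw [pull, this, ExteriorAlgebra.map_id]; rfl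

lemma pull_pull (A B : Cn n →L[ℝ] Cn n) (x : Lam n) : pull A (pull B x) = pull (B.comp A) x := by
  have : (pull A).comp (pull B) = pull (B.comp A) := ExteriorAlgebra.map_comp_map _ _
  exact DFunLike.congr_fun this x

/-- left multiplication as a continuous bilinear map -/
def mulL : Lam n →L[ℝ] Lam n →L[ℝ] Lam n :=
  LinearMap.toContinuousBilinearMap
    (LinearMap.mk₂ ℝ (fun a b : Lam n => a * b) add_mul
      (fun c a b => by
        change ((c : ℂ) • a) * b = (c : ℂ) • (a * b); rw [smul_mul_assoc])
      mul_add
      (fun c a b => by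
        change a * ((c : ℂ) • b) = (c : ℂ) • (a * b); rw [mul_smul_comm]))

@[simp] lemma mulL_apply (a b : Lam n) : mulL a b = a * b := rfl

/-- the grade involution -/
abbrev inv : Lam n →ₐ[ℂ] Lam n := CliffordAlgebra.involute

lemma inv_cov (α : Cot n) : inv (cov α) = - cov α := CliffordAlgebra.involute_ι α

lemma cov_mul (α : Cot n) (x : Lam n) : cov α * x = inv x * cov α := by
  induction x using ExteriorAlgebra.induction with
  | algebraMap r => rw [AlgHom.commutes]; exact (Algebra.commutes r _).symm
  | ι β =>
    have := ExteriorAlgebra.ι_add_mul_swap (R := ℂ) α β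
    change cov α * cov β = inv (cov β) * cov α
    rw [inv_cov, neg_mul]
    exact eq_neg_of_add_eq_zero_left this
  | mul a b ha hb => rw [← mul_assoc, ha, mul_assoc, hb, ← mul_assoc, map_mul]
  | add a b ha hb => rw [mul_add, ha, hb, map_add, add_mul]

lemma inv_of_mem {k : ℕ} {x : Lam n} (hx : x ∈ ⋀[ℂ]^k (Cot n)) : inv x = (-1 : ℂ) ^ k • x := by
  induction hx using Submodule.pow_induction_on_left' with
  | algebraMap r => simp
  | add x y i hx hy h1 h2 => rw [map_add, h1, h2, smul_add]
  | mem_mul m hm i x hx h =>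
    obtain ⟨α, rfl⟩ := hm
    rw [map_mul, h]
    change inv (cov α) * _ = _
    rw [inv_cov, Nat.succ_eq_add_one, pow_succ]
    simp

lemma mul_comm_of_mem {i j : ℕ} {x y : Lam n} (hx : x ∈ ⋀[ℂ]^i (Cot n))
    (hy : y ∈ ⋀[ℂ]^j (Cot n)) : x * y = (-1 : ℂ) ^ (i * j) • (y * x) := by
  induction hx using Submodule.pow_induction_on_left' with
  | algebraMap r => simp [Algebra.commutes]
  | add x y i hx hy h1 h2 => rw [add_mul, h1, h2, mul_add, smul_add]
  | mem_mul m hm i x hx h =>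
    obtain ⟨α, rfl⟩ := hm
    rw [mul_assoc, h, mul_smul_comm, ← mul_assoc]
    change _ • (cov α * y * x) = _ • (y * (cov α * x))
    rw [cov_mul, inv_of_mem hy, ← mul_assoc, smul_mul_assoc, smul_mul_assoc, smul_smul, ← pow_add]
    congr 2
    rw [Nat.succ_eq_add_one]; ring

lemma inv_pull (A : Cn n →L[ℝ] Cn n) (x : Lam n) : inv (pull A x) = pull A (inv x) := by
  have : (inv : Lam n →ₐ[ℂ] Lam n).comp (pull A) = (pull A).comp inv := by
    apply ExteriorAlgebra.hom_ext
    ext α : 1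
    change inv (pull A (cov α)) = pull A (inv (cov α))
    rw [pull_cov, inv_cov, inv_cov, map_neg, pull_cov]
  exact DFunLike.congr_fun this x

lemma ext_succ (k : ℕ) : ⋀[ℂ]^(k + 1) (Cot n) =
    LinearMap.range (ExteriorAlgebra.ι ℂ : Cot n →ₗ[ℂ] Lam n) * ⋀[ℂ]^k (Cot n) :=
  pow_succ' _ _

lemma pull_mem (A : Cn n →L[ℝ] Cn n) {k : ℕ} {x : Lam n} (hx : x ∈ ⋀[ℂ]^k (Cot n)) :
    pull A x ∈ ⋀[ℂ]^k (Cot n) := by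
  induction hx using Submodule.pow_induction_on_left' with
  | algebraMap r =>
    rw [AlgHom.commutes]
    exact (pow_zero (LinearMap.range (ExteriorAlgebra.ι ℂ : Cot n →ₗ[ℂ] Lam n))).ge
      (Submodule.algebraMap_mem r)
  | add x y i hx hy h1 h2 => rw [map_add]; exact Submodule.add_mem _ h1 h2
  | mem_mul m hm i x hx h =>
    obtain ⟨α, rfl⟩ := hm
    rw [map_mul, Nat.succ_eq_add_one, ext_succ]
    refine Submodule.mul_mem_mul ?_ h
    exact ⟨_, (pull_cov A α).symm⟩

lemma cov_mul_mem (α : Cot n) {k : ℕ} {x : Lam n} (hx : x ∈ ⋀[ℂ]^k (Cot n)) :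
    cov α * x ∈ ⋀[ℂ]^(k + 1) (Cot n) := by
  rw [ext_succ]
  exact Submodule.mul_mem_mul ⟨_, rfl⟩ hx

/-! ### Calculus on `ℂⁿ` -/

lemma dLin_add (L M : Cn n →L[ℝ] Lam n) : dLin (L + M) = dLin L + dLin M := by
  simp only [dLin, ← Finset.sum_add_distrib, add_apply, mul_add]
  exact Finset.sum_congr rfl fun j _ => by abel

lemma dLin_smul (c : ℂ) (L : Cn n →L[ℝ] Lam n) : dLin (c • L) = c • dLin L := by
  simp only [dLin, Finset.smul_sum, smul_apply, mul_smul_comm, smul_add]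

/-- `dLin` as a continuous linear map -/
def dLinL : (Cn n →L[ℝ] Lam n) →L[ℝ] Lam n :=
  LinearMap.toContinuousLinearMap
    { toFun := dLin, map_add' := dLin_add, map_smul' := fun c L => dLin_smul (c : ℂ) L }

lemma dLinL_apply (L : Cn n →L[ℝ] Lam n) : dLinL L = dLin L := rfl

lemma delLin_add (L M : Cn n →L[ℝ] Lam n) : delLin (L + M) = delLin L + delLin M := by
  simp only [delLin, ← Finset.sum_add_distrib, evalZ, add_apply]
  exact Finset.sum_congr rfl fun j _ => by rw [← mul_add]; congr 1; module

lemma delLin_smul (c : ℂ) (L : Cn n →L[ℝ] Lam n) : delLin (c • L) = c • delLin L := by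
  simp only [delLin, Finset.smul_sum, evalZ, smul_apply]
  exact Finset.sum_congr rfl fun j _ => by rw [← mul_smul_comm]; congr 1; module

/-- `delLin` as a continuous linear map -/
def delLinL : (Cn n →L[ℝ] Lam n) →L[ℝ] Lam n :=
  LinearMap.toContinuousLinearMap
    { toFun := delLin, map_add' := delLin_add, map_smul' := fun c L => delLin_smul (c : ℂ) L }

lemma hasFDerivAt_mul {f g : Cn n → Lam n} {f' g' : Cn n →L[ℝ] Lam n} {y : Cn n}
    (hf : HasFDerivAt f f' y) (hg : HasFDerivAt g g' y) :
    HasFDerivAt (fun x => f x * g x)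
      (((mulL.precompR (Cn n)) (f y)) g' + ((mulL.precompL (Cn n)) f') (g y)) y :=
  mulL.hasFDerivAt_of_bilinear hf hg

lemma dLin_leibniz (a b : Lam n) (f' g' : Cn n →L[ℝ] Lam n) :
    dLin ((mulL.precompR (Cn n)) a g' + (mulL.precompL (Cn n)) f' b)
      = dLin f' * b + inv a * dLin g' := by
  have h : ∀ v, ((mulL.precompR (Cn n)) a g' + (mulL.precompL (Cn n)) f' b) v
      = a * g' v + f' v * b := fun v => rfl
  simp only [dLin, Finset.sum_mul, Finset.mul_sum, ← Finset.sum_add_distrib, h]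
  refine Finset.sum_congr rfl fun j _ => ?_
  simp only [mul_add, add_mul, ← mul_assoc, cov_mul _ a]
  abel

lemma dLoc_mul {f g : Cn n → Lam n} {y : Cn n} (hf : DifferentiableAt ℝ f y)
    (hg : DifferentiableAt ℝ g y) :
    dLoc (fun x => f x * g x) y = dLoc f y * g y + inv (f y) * dLoc g y := by
  rw [dLoc_eq, dLoc_eq, dLoc_eq, (hasFDerivAt_mul hf.hasFDerivAt hg.hasFDerivAt).fderiv,
    dLin_leibniz]

lemma cov_anticomm (α β : Cot n) : cov α * cov β = - (cov β * cov α) :=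
  eq_neg_of_add_eq_zero_left (ExteriorAlgebra.ι_add_mul_swap (R := ℂ) α β)

lemma sum_antisymm {ι : Type*} [Fintype ι] (θ : ι → Cot n) (B : ι → ι → Lam n)
    (hB : ∀ a b, B a b = B b a) : ∑ a, ∑ b, cov (θ a) * (cov (θ b) * B a b) = 0 := by
  set S := ∑ a, ∑ b, cov (θ a) * (cov (θ b) * B a b) with hS
  have h : S = - S := by
    conv_lhs => rw [hS, Finset.sum_comm]
    rw [hS, ← Finset.sum_neg_distrib]
    refine Finset.sum_congr rfl fun a _ => ?_
    rw [← Finset.sum_neg_distrib]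
    refine Finset.sum_congr rfl fun b _ => ?_
    rw [← mul_assoc, ← mul_assoc, cov_anticomm, hB, neg_mul]
  have h2 : (2 : ℂ) • S = 0 := by
    rw [two_smul]; nth_rewrite 1 [h]; exact neg_add_cancel S
  exact (smul_eq_zero.mp h2).resolve_left two_ne_zero

/-- the real coordinate covectors, with one index -/
def reCov : Fin n ⊕ Fin n → Cot n := Sum.elim dRe dIm
/-- the real coordinate vectors, with one index -/
def reVec : Fin n ⊕ Fin n → Cn n := Sum.elim vecE fun j => Complex.I • vecE j

lemma dLin_sum (L : Cn n →L[ℝ] Lam n) : dLin L = ∑ a, cov (reCov a) * L (reVec a) := by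
  simp only [dLin, Fintype.sum_sum_type, Finset.sum_add_distrib, reCov, reVec, Sum.elim_inl,
    Sum.elim_inr]

lemma cot_sum (α : Cot n) : α = ∑ a, α (reVec a) • reCov a := by
  simp only [Fintype.sum_sum_type, reCov, reVec, Sum.elim_inl, Sum.elim_inr]
  ext v
  conv_lhs => rw [vec_decomp v]
  simp only [map_sum, map_add, map_smul, add_apply, FunLike.coe_sum, Finset.sum_apply, smul_apply,
    dRe_apply, dIm_apply, Finset.sum_add_distrib, smul_eq_mul, Complex.real_smul]
  congr 1 <;> exact Finset.sum_congr rfl fun j _ => mul_comm _ _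

lemma dLin_comp_clm (L : Cn n →L[ℝ] Cn n →L[ℝ] Lam n)
    (hL : ∀ v w, L v w = L w v) : dLin (dLinL.comp L) = 0 := by
  rw [dLin_sum]
  simp only [ContinuousLinearMap.comp_apply, dLinL_apply, dLin_sum, Finset.mul_sum]
  exact sum_antisymm reCov (fun a b => L (reVec a) (reVec b)) fun a b => hL _ _

lemma symm_fderiv {F : Type*} [NormedAddCommGroup F] [NormedSpace ℝ F] {f : Cn n → F} {y : Cn n}
    (hf : ContDiffAt ℝ ∞ f y) (v w : Cn n) :
    fderiv ℝ (fderiv ℝ f) y v w = fderiv ℝ (fderiv ℝ f) y w v :=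
  hf.isSymmSndFDerivAt (by simpa using ENat.LEInfty.out) v w

lemma differentiableAt_fderiv {F : Type*} [NormedAddCommGroup F] [NormedSpace ℝ F] {f : Cn n → F}
    {y : Cn n} (hf : ContDiffAt ℝ ∞ f y) : DifferentiableAt ℝ (fderiv ℝ f) y :=
  ((hf.of_le (m := 2) ENat.LEInfty.out).fderiv_right (m := 1) one_add_one_eq_two.le).differentiableAt (by simp)

lemma dLoc_dLoc {f : Cn n → Lam n} {y : Cn n} (hf : ContDiffAt ℝ ∞ f y) :
    dLoc (dLoc f) y = 0 := by
  have h1 : dLoc f = fun x => dLinL (fderiv ℝ f x) := funext fun x => dLoc_eq f x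
  rw [dLoc_eq, h1]
  have h2 := (dLinL (n := n)).hasFDerivAt.comp y (differentiableAt_fderiv hf).hasFDerivAt
  have h3 : fderiv ℝ (fun x => dLinL (fderiv ℝ f x)) y = _ := h2.fderiv
  rw [h3]
  exact dLin_comp_clm _ (symm_fderiv hf)

/-! ### Naturality of `d` -/

/-- `d` commutes with pullback, for a given form `f` at a given point -/
def NaturalAt (g : Cn n → Cn n) (y : Cn n) (f : Cn n → Lam n) : Prop :=
  DifferentiableAt ℝ f (g y) ∧
  DifferentiableAt ℝ (fun x => pull (fderiv ℝ g x) (f (g x))) y ∧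
  dLoc (fun x => pull (fderiv ℝ g x) (f (g x))) y = pull (fderiv ℝ g y) (dLoc f (g y))

variable {g : Cn n → Cn n} {y : Cn n}

lemma nat_add {f₁ f₂ : Cn n → Lam n} (h₁ : NaturalAt g y f₁) (h₂ : NaturalAt g y f₂) :
    NaturalAt g y (fun x => f₁ x + f₂ x) := by
  obtain ⟨a1, b1, c1⟩ := h₁
  obtain ⟨a2, b2, c2⟩ := h₂
  refine ⟨a1.add a2, ?_, ?_⟩
  · simp only [map_add]; exact b1.add b2
  · simp only [map_add]
    rw [dLoc_eq, fderiv_fun_add b1 b2, dLin_add, ← dLoc_eq, ← dLoc_eq, c1, c2, dLoc_eq f₁,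
      dLoc_eq f₂, dLoc_eq, fderiv_fun_add a1 a2, dLin_add, map_add]

lemma nat_mul {f₁ f₂ : Cn n → Lam n} (h₁ : NaturalAt g y f₁) (h₂ : NaturalAt g y f₂) :
    NaturalAt g y (fun x => f₁ x * f₂ x) := by
  obtain ⟨a1, b1, c1⟩ := h₁
  obtain ⟨a2, b2, c2⟩ := h₂
  refine ⟨(hasFDerivAt_mul a1.hasFDerivAt a2.hasFDerivAt).differentiableAt, ?_, ?_⟩
  · simp only [map_mul]
    exact (hasFDerivAt_mul b1.hasFDerivAt b2.hasFDerivAt).differentiableAt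
  · simp only [map_mul]
    rw [dLoc_mul b1 b2, c1, c2, dLoc_mul a1 a2, map_add, map_mul, map_mul, inv_pull]

lemma dLin_const_mul_scalar (L : Cn n →L[ℝ] ℂ) :
    dLin ((Algebra.linearMap ℂ (Lam n)).toContinuousLinearMap.restrictScalars ℝ ∘L L) =
      cov L := by
  conv_rhs => rw [cot_sum L]
  rw [dLin_sum, cov, map_sum]
  refine Finset.sum_congr rfl fun a _ => ?_
  simp only [ContinuousLinearMap.comp_apply, ContinuousLinearMap.coe_restrictScalars',
    LinearMap.coe_toContinuousLinearMap', Algebra.linearMap_apply, map_smul]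
  rw [← Algebra.commutes, Algebra.smul_def]

lemma nat_scalar {u : Cn n → ℂ} (hg : DifferentiableAt ℝ g y) (hu : DifferentiableAt ℝ u (g y)) :
    NaturalAt g y (fun x => algebraMap ℂ (Lam n) (u x)) := by
  have key : ∀ {w : Cn n → ℂ} {z : Cn n}, DifferentiableAt ℝ w z →
      HasFDerivAt (fun x => algebraMap ℂ (Lam n) (w x))
        ((Algebra.linearMap ℂ (Lam n)).toContinuousLinearMap.restrictScalars ℝ ∘L fderiv ℝ w z) z :=
    fun {w z} hw => ((Algebra.linearMap ℂ (Lam n)).toContinuousLinearMap.restrictScalars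
      ℝ).hasFDerivAt.comp z hw.hasFDerivAt
  have hug : DifferentiableAt ℝ (fun x => u (g x)) y := hu.comp y hg
  simp only [NaturalAt, AlgHom.commutes]
  refine ⟨(key hu).differentiableAt, (key hug).differentiableAt, ?_⟩
  rw [dLoc_eq, dLoc_eq, (key hug).fderiv, (key hu).fderiv, dLin_const_mul_scalar,
    dLin_const_mul_scalar, pull_cov]
  congr 1
  exact fderiv_fun_comp y hu hg

lemma nat_cov (hg : ContDiffAt ℝ ∞ g y) (α : Cot n) : NaturalAt g y (fun _ => cov α) := by
  have h1 : HasFDerivAt (fun x => α.comp (fderiv ℝ g x))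
      ((ContinuousLinearMap.compL ℝ (Cn n) (Cn n) ℂ α).comp (fderiv ℝ (fderiv ℝ g) y)) y :=
    (ContinuousLinearMap.compL ℝ (Cn n) (Cn n) ℂ α).hasFDerivAt.comp y
      (differentiableAt_fderiv hg).hasFDerivAt
  have h2 := ((ExteriorAlgebra.ι ℂ : Cot n →ₗ[ℂ] Lam n).toContinuousLinearMap.restrictScalars
      ℝ).hasFDerivAt.comp y h1
  have h3 : (fun x => pull (fderiv ℝ g x) (cov α)) = fun x => cov (α.comp (fderiv ℝ g x)) :=
    funext fun x => pull_cov _ _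
  refine ⟨differentiableAt_const _, ?_, ?_⟩
  · rw [h3]; exact h2.differentiableAt
  · have h4 : dLoc (fun _ : Cn n => cov α) (g y) = 0 := by
      rw [dLoc_eq, fderiv_fun_const]
      simp [dLin]
    have h5 : fderiv ℝ (fun x => cov (α.comp (fderiv ℝ g x))) y = _ := h2.fderiv
    rw [h3, h4, map_zero, dLoc_eq, h5, dLin_sum]
    have h6 : ∀ v : Cn n, cov (α.comp (fderiv ℝ (fderiv ℝ g) y v)) =
        ∑ b, cov (reCov b) * algebraMap ℂ (Lam n) (α (fderiv ℝ (fderiv ℝ g) y v (reVec b))) := by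
      intro v
      conv_lhs => rw [cot_sum (α.comp (fderiv ℝ (fderiv ℝ g) y v))]
      rw [cov, map_sum]
      refine Finset.sum_congr rfl fun b _ => ?_
      rw [map_smul, Algebra.smul_def, Algebra.commutes]; rfl
    have h7 : ∀ a, cov (reCov a) * cov (α.comp (fderiv ℝ (fderiv ℝ g) y (reVec a))) =
        ∑ b, cov (reCov a) * (cov (reCov b) *
          algebraMap ℂ (Lam n) (α (fderiv ℝ (fderiv ℝ g) y (reVec a) (reVec b)))) := by
      intro a; rw [h6, Finset.mul_sum]
    refine (Finset.sum_congr rfl fun a _ => h7 a).trans ?_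
    exact sum_antisymm reCov (fun a b => algebraMap ℂ (Lam n)
      (α (fderiv ℝ (fderiv ℝ g) y (reVec a) (reVec b)))) fun a b => by
        rw [symm_fderiv hg]

lemma nat_const (hg : ContDiffAt ℝ ∞ g y) (x : Lam n) : NaturalAt g y (fun _ => x) := by
  induction x using ExteriorAlgebra.induction with
  | algebraMap r => exact nat_scalar (hg.differentiableAt (by simp)) (differentiableAt_const r)
  | ι α => exact nat_cov hg α
  | mul a b ha hb => exact nat_mul ha hb
  | add a b ha hb => exact nat_add ha hb

lemma nat_all (hg : ContDiffAt ℝ ∞ g y) {f : Cn n → Lam n} (hf : DifferentiableAt ℝ f (g y)) :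
    NaturalAt g y f := by
  set b := Module.finBasis ℂ (Lam n)
  have h1 : f = fun x => ∑ i, algebraMap ℂ (Lam n) (b.repr (f x) i) * b i := by
    funext x
    conv_lhs => rw [← b.sum_repr (f x)]
    exact Finset.sum_congr rfl fun i _ => Algebra.smul_def _ _
  rw [h1]
  have h2 : ∀ i, NaturalAt g y (fun x => algebraMap ℂ (Lam n) (b.repr (f x) i) * b i) := fun i => by
    refine nat_mul (nat_scalar (hg.differentiableAt (by simp)) ?_) (nat_const hg _)
    exact ((b.coord i).toContinuousLinearMap.restrictScalars ℝ).differentiableAt.comp _ hf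
  have h3 : ∀ s : Finset (Fin _),
      NaturalAt g y (fun x => ∑ i ∈ s, algebraMap ℂ (Lam n) (b.repr (f x) i) * b i) := by
    intro s
    classical
    induction s using Finset.induction_on with
    | empty => simpa using nat_const hg (0 : Lam n)
    | insert i s hi h =>
      simp only [Finset.sum_insert hi]
      exact nat_add (h2 i) h
  exact h3 Finset.univ

/-! ### Naturality of `∂` under holomorphic maps -/

/-- multiplication by `i` -/
def mulI : Cn n →L[ℝ] Cn n := (Complex.I • ContinuousLinearMap.id ℂ (Cn n)).restrictScalars ℝ

@[simp] lemma mulI_apply (v : Cn n) : mulI v = Complex.I • v := rfl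

/-- `pull A` as a continuous linear map -/
def pullL (A : Cn n →L[ℝ] Cn n) : Lam n →L[ℝ] Lam n :=
  ((pull A).toLinearMap.toContinuousLinearMap).restrictScalars ℝ

lemma pullL_apply (A : Cn n →L[ℝ] Cn n) (x : Lam n) : pullL A x = pull A x := rfl

lemma I_smul_comp_neg (x : Lam n) : pull (-mulI) (pull mulI x) = x := by
  rw [pull_pull]
  have : (mulI : Cn n →L[ℝ] Cn n).comp (-mulI) = ContinuousLinearMap.id ℝ _ := by
    ext1 v
    simp only [ContinuousLinearMap.comp_apply, neg_apply, mulI_apply, map_neg, smul_smul,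
      Complex.I_mul_I, ContinuousLinearMap.id_apply]
    module
  rw [this, pull_id]

lemma delLin_J (L : Cn n →L[ℝ] Lam n) :
    delLin L = (1 / 2 : ℂ) • (dLin L + Complex.I • pull (-mulI) (dLin ((pullL mulI).comp L))) := by
  have h1 : ∀ j, evalZ ((pullL mulI).comp L) j = pull mulI (evalZ L j) := fun j => by
    simp only [evalZ, ContinuousLinearMap.comp_apply, pullL_apply, map_smul, map_sub]
  have h2 : ∀ j, evalZbar ((pullL mulI).comp L) j = pull mulI (evalZbar L j) := fun j => by
    simp only [evalZbar, ContinuousLinearMap.comp_apply, pullL_apply, map_smul, map_add]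
  have h3 : ∀ j, pull (-mulI) (cov (dz j : Cot n)) = -Complex.I • cov (dz j) := fun j => by
    rw [pull_cov, ← map_smul]; congr 1; ext v; simp
  have h4 : ∀ j, pull (-mulI) (cov (dzbar j : Cot n)) = Complex.I • cov (dzbar j) := fun j => by
    rw [pull_cov, ← map_smul]; congr 1; ext v; simp
  have h5 : pull (-mulI) (dLin ((pullL mulI).comp L)) =
      Complex.I • (delbarLin L - delLin L) := by
    rw [dLin_eq]
    simp only [delLin, delbarLin, h1, h2, map_add, map_sum, map_mul, h3, h4, I_smul_comp_neg,
      smul_sub, Finset.smul_sum, smul_mul_assoc, neg_smul, neg_mul, Finset.sum_neg_distrib]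
    abel
  rw [h5, dLin_eq, smul_smul, Complex.I_mul_I]
  module

/-- the differential commutes with multiplication by `i` near `y` -/
def HolNear (g : Cn n → Cn n) (y : Cn n) : Prop :=
  ∀ᶠ x in nhds y, ∀ v, fderiv ℝ g x (Complex.I • v) = Complex.I • fderiv ℝ g x v

lemma dLoc_congr {f₁ f₂ : Cn n → Lam n} {y : Cn n} (h : f₁ =ᶠ[nhds y] f₂) :
    dLoc f₁ y = dLoc f₂ y := by rw [dLoc_eq, dLoc_eq, h.fderiv_eq]

lemma delLoc_J {f : Cn n → Lam n} {y : Cn n} (hf : DifferentiableAt ℝ f y) :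
    delLoc f y = (1 / 2 : ℂ) • (dLoc f y + Complex.I • pull (-mulI)
      (dLoc (fun x => pull mulI (f x)) y)) := by
  have h : fderiv ℝ (fun x => pull mulI (f x)) y = (pullL mulI).comp (fderiv ℝ f y) :=
    ((pullL mulI).hasFDerivAt.comp y hf.hasFDerivAt).fderiv
  rw [delLoc, delLin_J, dLoc_eq, dLoc_eq, h]

lemma nat_del {g : Cn n → Cn n} {y : Cn n} (hg : ContDiffAt ℝ ∞ g y) (hol : HolNear g y)
    {f : Cn n → Lam n} (hf : DifferentiableAt ℝ f (g y)) :
    delLoc (fun x => pull (fderiv ℝ g x) (f (g x))) y = pull (fderiv ℝ g y) (delLoc f (g y)) := by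
  obtain ⟨-, h1, h2⟩ := nat_all hg hf
  have hf' : DifferentiableAt ℝ (fun x => pull mulI (f x)) (g y) :=
    (pullL mulI).differentiableAt.comp _ hf
  obtain ⟨-, -, h3⟩ := nat_all hg hf'
  have comm : ∀ {B : Cn n →L[ℝ] Cn n}, (∀ v, B (Complex.I • v) = Complex.I • B v) →
      B.comp mulI = mulI.comp B ∧ B.comp (-mulI) = (-mulI).comp B := fun {B} hB =>
    ⟨by ext1 v; exact hB v, by ext1 v; change B (-(Complex.I • v)) = -(Complex.I • B v);
                               rw [map_neg, hB]⟩
  have h4 : (fun x => pull mulI (pull (fderiv ℝ g x) (f (g x)))) =ᶠ[nhds y]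
      fun x => pull (fderiv ℝ g x) (pull mulI (f (g x))) := by
    filter_upwards [hol] with x hx
    rw [pull_pull, pull_pull, (comm hx).1]
  rw [delLoc_J h1, dLoc_congr h4, h3, h2, delLoc_J hf, map_smul, map_add, map_smul, pull_pull,
    pull_pull, (comm hol.self_of_nhds).2]

/-! ### Contraction with a vector-valued form -/

/-- `α ↦ α(∂/∂z_j)` -/
def evalZDual (j : Fin n) : Module.Dual ℂ (Cot n) where
  toFun α := evalZ α j
  map_add' α β := by simp only [evalZ, add_apply]; module
  map_smul' c α := by simp only [evalZ, smul_apply, RingHom.id_apply]; module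

/-- For `A = ∑_j A^j ⊗ ∂/∂z_j`, where `A^j = dz_j ∘ A`, the contraction
`x ↦ ∑_j A^j ∧ (∂/∂z_j ⌟ x)`. -/
def contr (A : Cn n →L[ℝ] Cn n) (x : Lam n) : Lam n :=
  ∑ j, cov ((dz j).comp A) * CliffordAlgebra.contractLeft (evalZDual j) x

lemma contr_add_right (A : Cn n →L[ℝ] Cn n) (x y : Lam n) :
    contr A (x + y) = contr A x + contr A y := by
  simp only [contr, map_add, mul_add, Finset.sum_add_distrib]

lemma contr_smul_right (A : Cn n →L[ℝ] Cn n) (c : ℂ) (x : Lam n) :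
    contr A (c • x) = c • contr A x := by
  simp only [contr, map_smul, mul_smul_comm, Finset.smul_sum]

lemma contr_add_left (A B : Cn n →L[ℝ] Cn n) (x : Lam n) :
    contr (A + B) x = contr A x + contr B x := by
  simp only [contr, ContinuousLinearMap.comp_add, cov, map_add, add_mul, Finset.sum_add_distrib]

lemma contr_smul_left (c : ℝ) (A : Cn n →L[ℝ] Cn n) (x : Lam n) :
    contr (c • A) x = c • contr A x := by
  have h : ∀ j, cov ((dz j).comp (c • A)) = (c : ℂ) • cov ((dz j).comp A) := fun j => by
    rw [← map_smul]; congr 1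
  simp only [contr, h, smul_mul_assoc]
  rw [← Finset.smul_sum]; rfl

/-- `contr` as a continuous bilinear map -/
def contrL : (Cn n →L[ℝ] Cn n) →L[ℝ] Lam n →L[ℝ] Lam n :=
  LinearMap.toContinuousBilinearMap
    (LinearMap.mk₂ ℝ contr contr_add_left contr_smul_left contr_add_right
      fun c A x => contr_smul_right A (c : ℂ) x)

lemma contrL_apply (A : Cn n →L[ℝ] Cn n) (x : Lam n) : contrL A x = contr A x := rfl

lemma contr_algebraMap (A : Cn n →L[ℝ] Cn n) (r : ℂ) : contr A (algebraMap ℂ (Lam n) r) = 0 := by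
  simp only [contr]
  refine Finset.sum_eq_zero fun j _ => ?_
  rw [CliffordAlgebra.contractLeft_algebraMap, mul_zero]

/-- the `(1,0)` part of `α`, composed with `A` -/
def tz (A : Cn n →L[ℝ] Cn n) (α : Cot n) : Cot n := ∑ j, evalZ α j • (dz j).comp A

lemma contr_cov_mul (A : Cn n →L[ℝ] Cn n) (α : Cot n) (x : Lam n) :
    contr A (cov α * x) = cov (tz A α) * x + cov α * contr A x := by
  simp only [contr, tz, cov, map_sum, map_smul, Finset.sum_mul, Finset.mul_sum,
    ← Finset.sum_add_distrib]
  refine Finset.sum_congr rfl fun j _ => ?_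
  rw [CliffordAlgebra.contractLeft_ι_mul, mul_sub, mul_smul_comm, smul_mul_assoc, ← mul_assoc,
    ← mul_assoc]
  have := cov_anticomm ((dz j).comp A) α
  change _ - cov ((dz j).comp A) * cov α * _ = _
  rw [this, neg_mul, sub_neg_eq_add]
  rfl

lemma contr_cov (A : Cn n →L[ℝ] Cn n) (α : Cot n) : contr A (cov α) = cov (tz A α) := by
  have h := contr_cov_mul A α 1
  have h1 : contr A (1 : Lam n) = 0 := by rw [← map_one (algebraMap ℂ (Lam n)), contr_algebraMap]
  rwa [mul_one, mul_one, h1, mul_zero, add_zero] at h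

lemma contr_mul (A : Cn n →L[ℝ] Cn n) (a b : Lam n) :
    contr A (a * b) = contr A a * b + a * contr A b := by
  induction a using ExteriorAlgebra.induction generalizing b with
  | algebraMap r =>
    rw [contr_algebraMap, zero_mul, zero_add, ← Algebra.smul_def, contr_smul_right,
      Algebra.smul_def]
  | ι α =>
    change contr A (cov α * b) = contr A (cov α) * b + cov α * contr A b
    rw [contr_cov, contr_cov_mul]
  | mul x y hx hy => rw [mul_assoc, hx, hy, hx]; noncomm_ring
  | add x y hx hy => rw [add_mul, contr_add_right, hx, hy, contr_add_right]; noncomm_ring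

lemma evalZ_sum (α : Cot n) (v : Cn n) :
    ∑ j, evalZ α j * v j = (1 / 2 : ℂ) * (α v - Complex.I * α (Complex.I • v)) := by
  have h1 := map_decomp (α : Cn n →ₗ[ℝ] ℂ) v
  have h2 := map_decomp (α : Cn n →ₗ[ℝ] ℂ) (Complex.I • v)
  simp only [ContinuousLinearMap.coe_coe] at h1 h2
  rw [h1, h2, Finset.mul_sum, ← Finset.sum_sub_distrib, Finset.mul_sum]
  refine Finset.sum_congr rfl fun j _ => ?_
  simp only [dz_apply, dzbar_apply, PiLp.smul_apply, smul_eq_mul, map_mul, Complex.conj_I]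
  linear_combination (1 / 2 : ℂ) * (v j * evalZ α j - (starRingEnd ℂ) (v j) * evalZbar α j) *
    Complex.I_mul_I

lemma tz_apply (A : Cn n →L[ℝ] Cn n) (α : Cot n) (v : Cn n) :
    tz A α v = (1 / 2 : ℂ) * (α (A v) - Complex.I * α (Complex.I • A v)) := by
  rw [← evalZ_sum]
  simp [tz]

lemma contr_pull {A A' B : Cn n →L[ℝ] Cn n} (hB : ∀ v, B (Complex.I • v) = Complex.I • B v)
    (h : ∀ v, A' (B v) = B (A v)) (x : Lam n) :
    contr A (pull B x) = pull B (contr A' x) := by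
  induction x using ExteriorAlgebra.induction with
  | algebraMap r => rw [AlgHom.commutes, contr_algebraMap, contr_algebraMap, map_zero]
  | ι α =>
    change contr A (pull B (cov α)) = pull B (contr A' (cov α))
    rw [pull_cov, contr_cov, contr_cov, pull_cov]
    congr 1
    ext v
    rw [ContinuousLinearMap.comp_apply, tz_apply, tz_apply, h, ContinuousLinearMap.comp_apply,
      ContinuousLinearMap.comp_apply, hB]
  | mul x y hx hy => rw [map_mul, contr_mul, hx, hy, contr_mul, map_add, map_mul, map_mul]
  | add x y hx hy => rw [map_add, contr_add_right, hx, hy, contr_add_right, map_add]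

/-! ### Differential forms on a complex manifold -/

/-- A function on a set, extended by `0`. -/
def extend (s : Set (Cn n)) (f : s → Lam n) : Cn n → Lam n := by
  classical exact fun y => if h : y ∈ s then f ⟨y, h⟩ else 0

lemma extend_of_mem {s : Set (Cn n)} (f : s → Lam n) {y : Cn n} (h : y ∈ s) :
    extend s f y = f ⟨y, h⟩ := by simp [extend, h]

lemma extend_coe {s : Set (Cn n)} (f : s → Lam n) (y : s) : extend s f y = f y :=
  extend_of_mem f y.2

variable (n) (X : Type u) [TopologicalSpace X] [ChartedSpace (Cn n) X]

/-- A family of (not necessarily smooth or compatible) forms on the ranges of the charts of the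
atlas of `X`. -/
abbrev PreForm := (e : atlas (Cn n) X) → e.1.target → Lam n

variable {n X}

/-- The transition map from the chart `e` to the chart `e'`. -/
def transition (e e' : atlas (Cn n) X) : Cn n → Cn n := fun y => e'.1 (e.1.symm y)

/-- A family of forms in charts is a smooth form on `X` if its members are smooth and if they are
related by pullback along the transition maps. -/
structure IsForm (w : PreForm n X) : Prop where
  smooth : ∀ e, ContDiffOn ℝ ∞ (extend e.1.target (w e)) e.1.target
  compat : ∀ (e e' : atlas (Cn n) X) (y : e.1.target) (hy : e.1.symm y ∈ e'.1.source),
    w e y = pull (fderiv ℝ (transition e e') y)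
      (w e' ⟨transition e e' y, e'.1.map_source hy⟩)

lemma smooth_congr {s : Set (Cn n)} {f : s → Lam n} {h : Cn n → Lam n}
    (hh : ContDiffOn ℝ ∞ h s) (hf : ∀ y : s, f y = h y) : ContDiffOn ℝ ∞ (extend s f) s :=
  hh.congr fun y hy => by rw [extend_of_mem f hy, hf]

lemma contDiffOn_mul {s : Set (Cn n)} {f h : Cn n → Lam n} (hf : ContDiffOn ℝ ∞ f s)
    (hh : ContDiffOn ℝ ∞ h s) : ContDiffOn ℝ ∞ (fun y => f y * h y) s :=
  (mulL (n := n)).isBoundedBilinearMap.contDiff.comp_contDiffOn (hf.prodMk hh)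

variable (n X) in
/-- The algebra `A^•(X)` of smooth complex-valued differential forms on `X`, with the wedge
product. -/
def Forms : Subalgebra ℂ (PreForm n X) where
  carrier := {w | IsForm w}
  mul_mem' {a b} ha hb :=
    ⟨fun e => smooth_congr (contDiffOn_mul (ha.smooth e) (hb.smooth e))
      fun y => by rw [extend_coe, extend_coe]; rfl,
    fun e e' y hy => by
      rw [Pi.mul_apply, Pi.mul_apply, Pi.mul_apply, Pi.mul_apply, map_mul, ← ha.compat _ _ _ hy,
        ← hb.compat _ _ _ hy]⟩
  add_mem' {a b} ha hb :=
    ⟨fun e => smooth_congr ((ha.smooth e).add (hb.smooth e))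
      fun y => by rw [extend_coe, extend_coe]; rfl,
    fun e e' y hy => by
      rw [Pi.add_apply, Pi.add_apply, Pi.add_apply, Pi.add_apply, map_add, ← ha.compat _ _ _ hy,
        ← hb.compat _ _ _ hy]⟩
  algebraMap_mem' r :=
    ⟨fun e => smooth_congr (h := fun _ => algebraMap ℂ (Lam n) r) contDiffOn_const fun y => rfl,
    fun e e' y hy => by
      rw [Pi.algebraMap_apply, Pi.algebraMap_apply, Pi.algebraMap_apply, Pi.algebraMap_apply,
        AlgHom.commutes]⟩

instance ring_forms : Ring (Forms n X) := inferInstance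
instance algebra_forms : Algebra ℂ (Forms n X) := inferInstance
instance module_forms : Module ℂ (Forms n X) := inferInstance
instance addCommGroup_forms : AddCommGroup (Forms n X) := inferInstance
instance addCommMonoid_forms : AddCommMonoid (Forms n X) := inferInstance

lemma transition_source_mem (e e' : atlas (Cn n) X) {y : Cn n} (hy : y ∈ e.1.target)
    (hy' : e.1.symm y ∈ e'.1.source) : (e.1.symm.trans e'.1).source ∈ nhds y :=
  (e.1.symm.trans e'.1).open_source.mem_nhds ⟨hy, hy'⟩

section manifold

variable [IsManifold 𝓘(ℂ, Cn n) ω X]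

lemma transition_contDiffAt (e e' : atlas (Cn n) X) {y : Cn n} (hy : y ∈ e.1.target)
    (hy' : e.1.symm y ∈ e'.1.source) : ContDiffAt ℂ ω (transition e e') y := by
  have h := HasGroupoid.compatible (G := contDiffGroupoid ω 𝓘(ℂ, Cn n)) e.2 e'.2
  rw [contDiffGroupoid, mem_groupoid_of_pregroupoid] at h
  have h1 := h.1
  simp only [contDiffPregroupoid] at h1
  have h2 : ContDiffOn ℂ ω (transition e e') (e.1.symm.trans e'.1).source := by
    have h3 : transition e e' = fun y => e'.1 (e.1.symm y) := rfl
    rw [h3]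
    simpa [Function.comp_def] using h1
  exact h2.contDiffAt (transition_source_mem e e' hy hy')

lemma transition_smooth (e e' : atlas (Cn n) X) {y : Cn n} (hy : y ∈ e.1.target)
    (hy' : e.1.symm y ∈ e'.1.source) : ContDiffAt ℝ ∞ (transition e e') y :=
  ((transition_contDiffAt e e' hy hy').restrict_scalars ℝ).of_le le_top

lemma transition_hol (e e' : atlas (Cn n) X) {y : Cn n} (hy : y ∈ e.1.target)
    (hy' : e.1.symm y ∈ e'.1.source) : HolNear (transition e e') y := by
  filter_upwards [transition_source_mem e e' hy hy'] with x hx v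
  have h := (transition_contDiffAt e e' hx.1 hx.2).differentiableAt (by simp)
  rw [h.fderiv_restrictScalars ℝ]
  simp

end manifold

/-- A first-order operator on forms on `ℂⁿ` that commutes with pullback along holomorphic maps. -/
structure LocalOp (T : (Cn n → Lam n) → Cn n → Lam n) : Prop where
  congr : ∀ {f g : Cn n → Lam n} {y : Cn n}, f =ᶠ[nhds y] g → T f y = T g y
  add : ∀ {f g : Cn n → Lam n} {y : Cn n}, DifferentiableAt ℝ f y → DifferentiableAt ℝ g y →
    T (fun x => f x + g x) y = T f y + T g y
  smul : ∀ (c : ℂ) {f : Cn n → Lam n} {y : Cn n}, DifferentiableAt ℝ f y →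
    T (fun x => c • f x) y = c • T f y
  smooth : ∀ {f : Cn n → Lam n} {s : Set (Cn n)}, IsOpen s → ContDiffOn ℝ ∞ f s →
    ContDiffOn ℝ ∞ (T f) s
  nat : ∀ {g : Cn n → Cn n} {y : Cn n} {f : Cn n → Lam n}, ContDiffAt ℝ ∞ g y → HolNear g y →
    DifferentiableAt ℝ f (g y) →
    T (fun x => pull (fderiv ℝ g x) (f (g x))) y = pull (fderiv ℝ g y) (T f (g y))

lemma contDiffOn_fderiv {f : Cn n → Lam n} {s : Set (Cn n)} (hs : IsOpen s)
    (hf : ContDiffOn ℝ ∞ f s) : ContDiffOn ℝ ∞ (fderiv ℝ f) s :=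
  hf.fderiv_of_isOpen hs (by simp)

lemma localOp_d : LocalOp (n := n) dLoc where
  congr := dLoc_congr
  add hf hg := by rw [dLoc_eq, dLoc_eq, dLoc_eq, fderiv_fun_add hf hg, dLin_add]
  smul c {f y} hf := by
    rw [dLoc_eq, dLoc_eq, fderiv_fun_const_smul hf c, dLin_smul]
  smooth {f s} hs hf := by
    have : dLoc f = fun y => dLinL (fderiv ℝ f y) := funext fun y => dLoc_eq f y
    rw [this]
    exact (dLinL (n := n)).contDiff.comp_contDiffOn (contDiffOn_fderiv hs hf)
  nat hg _ hf := (nat_all hg hf).2.2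

lemma localOp_del : LocalOp (n := n) delLoc where
  congr h := by rw [delLoc, delLoc, h.fderiv_eq]
  add hf hg := by rw [delLoc, delLoc, delLoc, fderiv_fun_add hf hg, delLin_add]
  smul c {f y} hf := by
    rw [delLoc, delLoc, fderiv_fun_const_smul hf c, delLin_smul]
  smooth {f s} hs hf :=
    (delLinL (n := n)).contDiff.comp_contDiffOn (contDiffOn_fderiv hs hf)
  nat hg hol hf := nat_del hg hol hf

lemma delbarLoc_eq (f : Cn n → Lam n) : delbarLoc f = fun y => dLoc f y - delLoc f y :=
  funext fun y => by rw [dLoc, add_sub_cancel_left]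

lemma localOp_delbar : LocalOp (n := n) delbarLoc where
  congr h := by rw [delbarLoc, delbarLoc, h.fderiv_eq]
  add hf hg := by
    simp only [delbarLoc_eq]; rw [localOp_d.add hf hg, localOp_del.add hf hg]; abel
  smul c {f y} hf := by
    simp only [delbarLoc_eq]; rw [localOp_d.smul c hf, localOp_del.smul c hf, smul_sub]
  smooth {f s} hs hf := by
    rw [delbarLoc_eq]; exact (localOp_d.smooth hs hf).sub (localOp_del.smooth hs hf)
  nat hg hol hf := by
    simp only [delbarLoc_eq]; rw [localOp_d.nat hg hol hf, localOp_del.nat hg hol hf, map_sub]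

lemma extend_smoothAt {w : PreForm n X} (hw : IsForm w) (e : atlas (Cn n) X) {y : Cn n}
    (hy : y ∈ e.1.target) : ContDiffAt ℝ ∞ (extend e.1.target (w e)) y :=
  (hw.smooth e).contDiffAt (e.1.open_target.mem_nhds hy)

lemma extend_diff {w : PreForm n X} (hw : IsForm w) (e : atlas (Cn n) X) {y : Cn n}
    (hy : y ∈ e.1.target) : DifferentiableAt ℝ (extend e.1.target (w e)) y :=
  (extend_smoothAt hw e hy).differentiableAt (by simp)

section manifold

variable [IsManifold 𝓘(ℂ, Cn n) ω X]

lemma LocalOp.isForm {T : (Cn n → Lam n) → Cn n → Lam n} (hT : LocalOp T) {w : PreForm n X}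
    (hw : IsForm w) : IsForm (fun e (y : e.1.target) => T (extend e.1.target (w e)) y) := by
  refine ⟨fun e => smooth_congr (hT.smooth e.1.open_target (hw.smooth e)) fun y => rfl,
    fun e e' y hy => ?_⟩
  have h1 : extend e.1.target (w e) =ᶠ[nhds (y : Cn n)] fun x =>
      pull (fderiv ℝ (transition e e') x) (extend e'.1.target (w e') (transition e e' x)) := by
    filter_upwards [transition_source_mem e e' y.2 hy] with x hx
    have hx1 : x ∈ e.1.target := hx.1
    rw [extend_of_mem _ hx1, hw.compat e e' ⟨x, hx1⟩ hx.2]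
    exact congrArg _ (extend_of_mem (w e') (e'.1.map_source hx.2)).symm
  rw [hT.congr h1, hT.nat (transition_smooth e e' y.2 hy) (transition_hol e e' y.2 hy)
    (extend_diff hw e' (e'.1.map_source hy))]

/-- The operator on forms on `X` given in every chart by `T`. -/
def liftOp (T : (Cn n → Lam n) → Cn n → Lam n) (hT : LocalOp T) :
    Forms n X →ₗ[ℂ] Forms n X where
  toFun w := ⟨fun e y => T (extend e.1.target (w.1 e)) y, hT.isForm w.2⟩
  map_add' a b := by
    apply Subtype.ext; funext e y
    have h : extend e.1.target ((a + b).1 e) =ᶠ[nhds (y : Cn n)]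
        fun x => extend e.1.target (a.1 e) x + extend e.1.target (b.1 e) x := by
      filter_upwards [e.1.open_target.mem_nhds y.2] with x hx
      rw [extend_of_mem _ hx, extend_of_mem _ hx, extend_of_mem _ hx]; rfl
    exact (hT.congr h).trans (hT.add (extend_diff a.2 e y.2) (extend_diff b.2 e y.2))
  map_smul' c a := by
    apply Subtype.ext; funext e y
    have h : extend e.1.target ((c • a).1 e) =ᶠ[nhds (y : Cn n)]
        fun x => c • extend e.1.target (a.1 e) x := by
      filter_upwards [e.1.open_target.mem_nhds y.2] with x hx
      rw [extend_of_mem _ hx, extend_of_mem _ hx]; rfl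
    exact (hT.congr h).trans (hT.smul c (extend_diff a.2 e y.2))

variable (n X) in
/-- The exterior derivative on `A^•(X)`. -/
def extD : Forms n X →ₗ[ℂ] Forms n X := liftOp dLoc localOp_d

variable (n X) in
/-- The operator `∂` on `A^•(X)`. -/
def del : Forms n X →ₗ[ℂ] Forms n X := liftOp delLoc localOp_del

variable (n X) in
/-- The operator `∂̄` on `A^•(X)`. -/
def delbar : Forms n X →ₗ[ℂ] Forms n X := liftOp delbarLoc localOp_delbar

end manifold

/-! ### Beltrami differentials -/

variable (n X) in
/-- A Beltrami differential `φ ∈ A^{0,1}(X, T^{1,0})`, given in every chart `z` by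
`∑_j φ^j ⊗ ∂/∂z_j` with smooth `(0,1)`-forms `φ^j = dz_j ∘ φ_z`: in the chart it is the
conjugate-linear map `φ_z(y) : ℂⁿ → ℂⁿ ≅ T^{1,0}`, where the `j`-th basis vector of `ℂⁿ` corresponds
to `∂/∂z_j`. On overlaps these maps are intertwined by the derivatives of the transition maps. -/
structure Beltrami where
  toFun : atlas (Cn n) X → Cn n → (Cn n →L[ℝ] Cn n)
  smooth : ∀ e, ContDiffOn ℝ ∞ (toFun e) e.1.target
  conj_linear : ∀ e, ∀ y ∈ e.1.target, ∀ v, toFun e y (Complex.I • v) = -(Complex.I • toFun e y v)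
  compat : ∀ e e' : atlas (Cn n) X, ∀ y ∈ e.1.target, e.1.symm y ∈ e'.1.source → ∀ v,
    toFun e' (transition e e' y) (fderiv ℝ (transition e e') y v) =
      fderiv ℝ (transition e e') y (toFun e y v)

namespace Beltrami

/-- The coefficient `φ^j_{k̄}` of `φ = ∑ φ^j_{k̄} dz̄_k ⊗ ∂/∂z_j` in the chart `e`. -/
def coeff (φ : Beltrami n X) (e : atlas (Cn n) X) (j k : Fin n) (y : Cn n) : ℂ :=
  φ.toFun e y (vecE k) j

/-- The Maurer–Cartan equation `∂̄φ = ½[φ,φ]`, in coordinates: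
`∂φ^i_{k̄}/∂z̄_j - ∂φ^i_{j̄}/∂z̄_k = ∑_l (φ^l_{j̄} ∂φ^i_{k̄}/∂z_l - φ^l_{k̄} ∂φ^i_{j̄}/∂z_l)`. -/
def MaurerCartan (φ : Beltrami n X) : Prop :=
  ∀ e : atlas (Cn n) X, ∀ y ∈ e.1.target, ∀ i j k : Fin n,
    evalZbar (fderiv ℝ (φ.coeff e i k) y) j - evalZbar (fderiv ℝ (φ.coeff e i j) y) k =
      ∑ l, (φ.coeff e l j y * evalZ (fderiv ℝ (φ.coeff e i k) y) l -
        φ.coeff e l k y * evalZ (fderiv ℝ (φ.coeff e i j) y) l)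

variable [IsManifold 𝓘(ℂ, Cn n) ω X]

/-- The contraction `i_φ` on `A^•(X)`, in charts `η ↦ ∑_j φ^j ∧ (∂/∂z_j ⌟ η)`. -/
def contraction (φ : Beltrami n X) : Forms n X →ₗ[ℂ] Forms n X where
  toFun w := ⟨fun e y => contr (φ.toFun e y) (w.1 e y), by
    refine ⟨fun e => smooth_congr ((contrL (n := n)).isBoundedBilinearMap.contDiff.comp_contDiffOn
      ((φ.smooth e).prodMk (w.2.smooth e))) fun y => ?_, fun e e' y hy => ?_⟩
    · change _ = contr _ (extend _ _ _)
      rw [extend_coe]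
    · rw [w.2.compat e e' y hy]
      exact contr_pull (transition_hol e e' y.2 hy).self_of_nhds (φ.compat e e' y y.2 hy) _⟩
  map_add' a b := Subtype.ext <| funext fun e => funext fun y => contr_add_right _ _ _
  map_smul' c a := Subtype.ext <| funext fun e => funext fun y => contr_smul_right _ _ _

/-- `L_φ^{1,0} = i_φ ∂ - ∂ i_φ`. -/
def lie (φ : Beltrami n X) : Forms n X →ₗ[ℂ] Forms n X :=
  φ.contraction ∘ₗ del n X - del n X ∘ₗ φ.contraction

/-- `∂̄_φ = ∂̄ - L_φ^{1,0}`. -/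
def delbarPhi (φ : Beltrami n X) : Forms n X →ₗ[ℂ] Forms n X := delbar n X - φ.lie

/-- `d_φ = ∂ + ∂̄_φ`. -/
def dPhi (φ : Beltrami n X) : Forms n X →ₗ[ℂ] Forms n X := del n X + φ.delbarPhi

/-- The `∂∂̄_φ`-lemma: `ker ∂ ∩ ker ∂̄_φ ∩ im d_φ = im ∂∂̄_φ` on `A^•(X)`. -/
def DelDelbarLemma (φ : Beltrami n X) : Prop :=
  LinearMap.ker (del n X) ⊓ LinearMap.ker φ.delbarPhi ⊓ LinearMap.range φ.dPhi =
    LinearMap.range (del n X ∘ₗ φ.delbarPhi)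

end Beltrami

/-! ### Differential graded algebras and formality -/

/-- A (graded-commutative) differential graded algebra over `ℂ`, graded by `ℕ`, with a differential
of degree `1`. -/
structure DGA where
  carrier : Type u
  [ring : Ring carrier]
  [algebra : Algebra ℂ carrier]
  grading : ℕ → Submodule ℂ carrier
  [graded : GradedAlgebra grading]
  d : carrier →ₗ[ℂ] carrier
  d_mem : ∀ {i x}, x ∈ grading i → d x ∈ grading (i + 1)
  d_d : ∀ x, d (d x) = 0
  leibniz : ∀ {i x}, x ∈ grading i → ∀ y, d (x * y) = d x * y + (-1 : ℂ) ^ i • (x * d y)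
  comm : ∀ {i j x y}, x ∈ grading i → y ∈ grading j → x * y = (-1 : ℂ) ^ (i * j) • (y * x)

attribute [instance] DGA.ring DGA.algebra DGA.graded

/-- A grading from a family of projections. -/
@[reducible] def gradedOfProj {M : Type*} [Ring M] [Algebra ℂ M] (G : ℕ → Submodule ℂ M)
    [SetLike.GradedMonoid G] (p : ℕ → M →+ M) (hp : ∀ i x, p i x ∈ G i)
    (hid : ∀ i, ∀ x ∈ G i, p i x = x) (h0 : ∀ i j, i ≠ j → ∀ x ∈ G j, p i x = 0)
    (hfin : ∀ x, ∃ N, x = ∑ i ∈ Finset.range N, p i x) : GradedAlgebra G :=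
  have key : ∀ (i : ℕ) (x : ⨁ i, G i), p i (DirectSum.coeAddMonoidHom G x) = x i := by
    intro i x
    induction x using DirectSum.induction_on with
    | zero => simp
    | of j x =>
      rw [DirectSum.coeAddMonoidHom_of]
      by_cases h : i = j
      · subst h; rw [hid i x x.2, DirectSum.of_eq_same]
      · rw [h0 i j h x x.2, DirectSum.of_eq_of_ne _ _ _ h]; rfl
    | add x y hx hy => rw [map_add, map_add, hx, hy]; rfl
  have hint : DirectSum.IsInternal G := by
    refine ⟨fun x y hxy => ?_, fun x => ?_⟩
    · refine DFinsupp.ext fun i => Subtype.ext ?_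
      rw [← key, ← key, hxy]
    · obtain ⟨N, hN⟩ := hfin x
      refine ⟨∑ i ∈ Finset.range N, DirectSum.of (fun i => G i) i ⟨p i x, hp i x⟩, ?_⟩
      rw [map_sum]
      conv_rhs => rw [hN]
      exact Finset.sum_congr rfl fun i _ => DirectSum.coeAddMonoidHom_of _ _ _
  { toDecomposition := hint.chooseDecomposition }

namespace DGA

/-- the homogeneous component of degree `i` -/
abbrev proj (A : DGA.{u}) (i : ℕ) : A.carrier →ₗ[ℂ] A.carrier := GradedAlgebra.proj A.grading i

lemma proj_mem (A : DGA.{u}) (i : ℕ) (x : A.carrier) : A.proj i x ∈ A.grading i := by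
  rw [proj, GradedAlgebra.proj_apply]; exact SetLike.coe_mem _

lemma proj_same (A : DGA.{u}) {i : ℕ} {x : A.carrier} (hx : x ∈ A.grading i) : A.proj i x = x := by
  rw [proj, GradedAlgebra.proj_apply, DirectSum.decompose_of_mem_same _ hx]

lemma proj_ne (A : DGA.{u}) {i j : ℕ} (h : i ≠ j) {x : A.carrier} (hx : x ∈ A.grading j) :
    A.proj i x = 0 := by
  rw [proj, GradedAlgebra.proj_apply, DirectSum.decompose_of_mem_ne _ hx h.symm]

lemma sum_proj (A : DGA.{u}) (x : A.carrier) :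
    ∃ N, ∀ M, N ≤ M → x = ∑ i ∈ Finset.range M, A.proj i x := by
  classical
  obtain ⟨N, hN⟩ := (DirectSum.decompose A.grading x).support.exists_nat_subset_range
  refine ⟨N, fun M hM => ?_⟩
  conv_lhs => rw [← DirectSum.sum_support_decompose A.grading x]
  refine Finset.sum_subset (hN.trans (Finset.range_mono hM)) fun i _ hi => ?_
  simpa using hi

lemma induction_homogeneous (A : DGA.{u}) {C : A.carrier → Prop} (x : A.carrier)
    (h0 : C 0) (hadd : ∀ a b, C a → C b → C (a + b)) (hh : ∀ i, ∀ a ∈ A.grading i, C a) : C x :=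
  DirectSum.Decomposition.inductionOn A.grading h0 (fun {i} m => hh i m m.2) hadd x

lemma proj_d (A : DGA.{u}) (i : ℕ) (x : A.carrier) : A.proj (i + 1) (A.d x) = A.d (A.proj i x) := by
  induction x using A.induction_homogeneous with
  | h0 => simp
  | hadd a b ha hb => rw [map_add, map_add, ha, hb, map_add, map_add]
  | hh j a ha =>
    by_cases h : i = j
    · subst h; rw [A.proj_same (A.d_mem ha), A.proj_same ha]
    · rw [A.proj_ne (by omega) (A.d_mem ha), A.proj_ne h ha, map_zero]

lemma proj_zero_d (A : DGA.{u}) (x : A.carrier) : A.proj 0 (A.d x) = 0 := by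
  induction x using A.induction_homogeneous with
  | h0 => simp
  | hadd a b ha hb => rw [map_add, map_add, ha, hb, add_zero]
  | hh j a ha => exact A.proj_ne (by omega) (A.d_mem ha)

lemma d_proj (A : DGA.{u}) {x : A.carrier} (hx : A.d x = 0) (i : ℕ) : A.d (A.proj i x) = 0 := by
  rw [← proj_d, hx, map_zero]

lemma d_mul_closed (A : DGA.{u}) (x : A.carrier) {y : A.carrier} (hy : A.d y = 0) :
    A.d (x * y) = A.d x * y := by
  induction x using A.induction_homogeneous with
  | h0 => simp
  | hadd a b ha hb => rw [add_mul, map_add, ha, hb, map_add, add_mul]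
  | hh j a ha => rw [A.leibniz ha, hy, mul_zero, smul_zero, add_zero]

lemma closed_mul_d (A : DGA.{u}) {x : A.carrier} (hx : A.d x = 0) (y : A.carrier) :
    ∃ z, A.d z = x * A.d y := by
  obtain ⟨N, hN⟩ := A.sum_proj x
  refine ⟨∑ i ∈ Finset.range N, (-1 : ℂ) ^ i • (A.proj i x * y), ?_⟩
  conv_rhs => rw [hN N le_rfl]
  rw [map_sum, Finset.sum_mul]
  refine Finset.sum_congr rfl fun i _ => ?_
  rw [map_smul, A.leibniz (A.proj_mem i x), A.d_proj hx, zero_mul, zero_add, smul_smul, ← mul_pow]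
  simp

lemma d_one (A : DGA.{u}) : A.d 1 = 0 := by
  have h := A.leibniz (SetLike.GradedOne.one_mem : (1 : A.carrier) ∈ A.grading 0) 1
  rw [mul_one, mul_one, one_mul, pow_zero, one_smul] at h
  exact left_eq_add.mp h

/-- The subalgebra `ker d` of cocycles. -/
def cocycles (A : DGA.{u}) : Subalgebra ℂ A.carrier where
  carrier := {x | A.d x = 0}
  mul_mem' {a b} ha hb := by
    change A.d (a * b) = 0
    rw [A.d_mul_closed a hb, show A.d a = 0 from ha, zero_mul]
  add_mem' {a b} ha hb := by
    change A.d (a + b) = 0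
    rw [map_add, show A.d a = 0 from ha, show A.d b = 0 from hb, add_zero]
  algebraMap_mem' r := by
    change A.d (algebraMap ℂ A.carrier r) = 0
    rw [Algebra.algebraMap_eq_smul_one, map_smul, A.d_one, smul_zero]

/-- The ideal `im d` of coboundaries in `ker d`. -/
def coboundaries (A : DGA.{u}) : Ideal A.cocycles where
  carrier := {x | ∃ y, A.d y = x}
  add_mem' := by
    rintro _ _ ⟨x, hx⟩ ⟨y, hy⟩
    exact ⟨x + y, by rw [map_add, hx, hy]; rfl⟩
  zero_mem' := ⟨0, map_zero _⟩
  smul_mem' := by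
    rintro c x ⟨y, hy⟩
    obtain ⟨z, hz⟩ := A.closed_mul_d c.2 y
    exact ⟨z, by rw [hz, hy]; rfl⟩

instance isTwoSided_coboundaries (A : DGA.{u}) : A.coboundaries.IsTwoSided where
  mul_mem_of_left := by
    rintro _ b ⟨y, hy⟩
    exact ⟨y * b, by rw [A.d_mul_closed y b.2, hy]; rfl⟩

/-- The cohomology algebra `ker d / im d`. -/
abbrev CohomologyAlgebra (A : DGA.{u}) : Type u := A.cocycles ⧸ A.coboundaries

/-- The classes of the cocycles of degree `i`. -/
def cohomologyGrading (A : DGA.{u}) (i : ℕ) : Submodule ℂ A.CohomologyAlgebra :=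
  ((A.grading i).comap A.cocycles.val.toLinearMap).map
    (Ideal.Quotient.mkₐ ℂ A.coboundaries).toLinearMap

lemma mem_cohomologyGrading (A : DGA.{u}) {i : ℕ} {h : A.CohomologyAlgebra} :
    h ∈ A.cohomologyGrading i ↔
      ∃ z : A.cocycles, (z : A.carrier) ∈ A.grading i ∧ Ideal.Quotient.mk A.coboundaries z = h :=
  Iff.rfl

instance gradedMonoid_cohomology (A : DGA.{u}) : SetLike.GradedMonoid A.cohomologyGrading where
  one_mem := ⟨1, SetLike.GradedOne.one_mem (A := A.grading), map_one (Ideal.Quotient.mk A.coboundaries)⟩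
  mul_mem := by
    rintro i j _ _ ⟨a, ha, rfl⟩ ⟨b, hb, rfl⟩
    exact ⟨a * b, SetLike.GradedMul.mul_mem (A := A.grading) ha hb,
      map_mul (Ideal.Quotient.mk A.coboundaries) a b⟩

/-- the homogeneous component of degree `i` of a cocycle -/
def projCocycles (A : DGA.{u}) (i : ℕ) : A.cocycles →+ A.cocycles where
  toFun z := ⟨A.proj i z, A.d_proj z.2 i⟩
  map_zero' := Subtype.ext (map_zero _)
  map_add' a b := Subtype.ext (map_add _ _ _)

lemma projCocycles_mem (A : DGA.{u}) (i : ℕ) {z : A.cocycles} (hz : z ∈ A.coboundaries) :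
    A.projCocycles i z ∈ A.coboundaries := by
  obtain ⟨y, hy⟩ := hz
  cases i with
  | zero => exact ⟨0, by rw [map_zero]; change _ = A.proj 0 z; rw [← hy, A.proj_zero_d]⟩
  | succ i => exact ⟨A.proj i y, by change _ = A.proj (i + 1) z; rw [← hy, A.proj_d]⟩

/-- the homogeneous component of degree `i` of a cohomology class -/
def projCohomology (A : DGA.{u}) (i : ℕ) : A.CohomologyAlgebra →+ A.CohomologyAlgebra :=
  QuotientAddGroup.map A.coboundaries.toAddSubgroup A.coboundaries.toAddSubgroup
    (A.projCocycles i) fun _ hz => A.projCocycles_mem i hz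

lemma projCohomology_mk (A : DGA.{u}) (i : ℕ) (z : A.cocycles) :
    A.projCohomology i (Ideal.Quotient.mk A.coboundaries z) =
      Ideal.Quotient.mk A.coboundaries (A.projCocycles i z) := rfl

instance graded_cohomology (A : DGA.{u}) : GradedAlgebra A.cohomologyGrading :=
  gradedOfProj A.cohomologyGrading A.projCohomology
    (fun i x => by
      obtain ⟨z, rfl⟩ := Ideal.Quotient.mk_surjective x
      exact ⟨A.projCocycles i z, A.proj_mem i z, rfl⟩)
    (by
      rintro i _ ⟨z, hz, rfl⟩
      change A.projCohomology i (Ideal.Quotient.mk _ z) = Ideal.Quotient.mk _ z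
      rw [projCohomology_mk]
      congr 1
      exact Subtype.ext (A.proj_same hz))
    (by
      rintro i j hij _ ⟨z, hz, rfl⟩
      change A.projCohomology i (Ideal.Quotient.mk _ z) = 0
      rw [projCohomology_mk, ← map_zero (Ideal.Quotient.mk A.coboundaries)]
      congr 1
      exact Subtype.ext (A.proj_ne hij hz))
    (fun x => by
      obtain ⟨z, rfl⟩ := Ideal.Quotient.mk_surjective x
      obtain ⟨N, hN⟩ := A.sum_proj z
      refine ⟨N, ?_⟩
      simp only [projCohomology_mk]
      rw [← map_sum]
      congr 1
      refine Subtype.ext ((hN N le_rfl).trans ?_)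
      rw [AddSubmonoidClass.coe_finsetSum]
      rfl)

/-- The cohomology algebra of `A`, as a differential graded algebra with zero differential. -/
def cohomology (A : DGA.{u}) : DGA.{u} where
  carrier := A.CohomologyAlgebra
  grading := A.cohomologyGrading
  d := 0
  d_mem _ := Submodule.zero_mem _
  d_d _ := rfl
  leibniz _ _ := by simp
  comm := by
    rintro i j _ _ ⟨a, ha, rfl⟩ ⟨b, hb, rfl⟩
    have h : a * b = (-1 : ℂ) ^ (i * j) • (b * a) := Subtype.ext (A.comm ha hb)
    change Ideal.Quotient.mkₐ ℂ _ a * Ideal.Quotient.mkₐ ℂ _ b =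
      _ • (Ideal.Quotient.mkₐ ℂ _ b * Ideal.Quotient.mkₐ ℂ _ a)
    rw [← map_mul, h, map_smul, map_mul]

/-- A homomorphism of differential graded algebras. -/
structure Hom (A B : DGA.{u}) where
  toAlgHom : A.carrier →ₐ[ℂ] B.carrier
  map_mem : ∀ {i x}, x ∈ A.grading i → toAlgHom x ∈ B.grading i
  map_d : ∀ x, toAlgHom (A.d x) = B.d (toAlgHom x)

namespace Hom

variable {A B : DGA.{u}}

/-- The restriction of a homomorphism to cocycles. -/
def onCocycles (f : Hom A B) : A.cocycles →ₐ[ℂ] B.cocycles :=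
  (f.toAlgHom.comp A.cocycles.val).codRestrict B.cocycles fun z => by
    change B.d (f.toAlgHom z) = 0
    rw [← f.map_d, show A.d z = 0 from z.2, map_zero]

/-- The map induced on cohomology. -/
def onCohomology (f : Hom A B) : A.CohomologyAlgebra →+* B.CohomologyAlgebra :=
  Ideal.quotientMap B.coboundaries (f.onCocycles : A.cocycles →+* B.cocycles) <| by
    rintro z ⟨y, hy⟩
    exact ⟨f.toAlgHom y, by rw [← f.map_d, hy]; rfl⟩

/-- A quasi-isomorphism is a homomorphism that induces an isomorphism on cohomology. -/
def IsQuasiIso (f : Hom A B) : Prop := Function.Bijective f.onCohomology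

end Hom

/-- `A` is formal if it is connected to its cohomology algebra (with zero differential) by a finite
chain of quasi-isomorphisms, of either direction, of differential graded algebras. -/
def IsFormal (A : DGA.{u}) : Prop :=
  Relation.EqvGen (fun B C : DGA.{u} => ∃ f : Hom B C, f.IsQuasiIso) A A.cohomology

end DGA

/-! ### The de Rham algebra -/

/-- The forms of degree `k`. -/
def formGrading (n : ℕ) (X : Type u) [TopologicalSpace X] [ChartedSpace (Cn n) X] (k : ℕ) :
    Submodule ℂ (Forms n X) where
  carrier := {w | ∀ e y, w.1 e y ∈ ⋀[ℂ]^k (Cot n)}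
  add_mem' ha hb e y := Submodule.add_mem _ (ha e y) (hb e y)
  zero_mem' _ _ := Submodule.zero_mem _
  smul_mem' c _ ha e y := Submodule.smul_mem _ c (ha e y)

instance gradedMonoid_forms (n : ℕ) (X : Type u) [TopologicalSpace X] [ChartedSpace (Cn n) X] :
    SetLike.GradedMonoid (formGrading n X) where
  one_mem _ _ := SetLike.GradedOne.one_mem (A := fun i : ℕ => ⋀[ℂ]^i (Cot n))
  mul_mem _ _ _ _ ha hb e y :=
    SetLike.GradedMul.mul_mem (A := fun i : ℕ => ⋀[ℂ]^i (Cot n)) (ha e y) (hb e y)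

/-- the component of degree `k` in the fibre -/
abbrev lamProj (k : ℕ) : Lam n →ₗ[ℂ] Lam n := GradedAlgebra.proj (fun i : ℕ => ⋀[ℂ]^i (Cot n)) k

lemma lamProj_mem (k : ℕ) (x : Lam n) : lamProj k x ∈ ⋀[ℂ]^k (Cot n) := by
  rw [lamProj, GradedAlgebra.proj_apply]; exact SetLike.coe_mem _

lemma lamProj_same {k : ℕ} {x : Lam n} (hx : x ∈ ⋀[ℂ]^k (Cot n)) : lamProj k x = x := by
  rw [lamProj, GradedAlgebra.proj_apply]
  exact DirectSum.decompose_of_mem_same (fun i : ℕ => ⋀[ℂ]^i (Cot n)) hx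

lemma lamProj_ne {k l : ℕ} (h : k ≠ l) {x : Lam n} (hx : x ∈ ⋀[ℂ]^l (Cot n)) :
    lamProj k x = 0 := by
  rw [lamProj, GradedAlgebra.proj_apply]
  exact DirectSum.decompose_of_mem_ne (fun i : ℕ => ⋀[ℂ]^i (Cot n)) hx h.symm

lemma lam_sum_proj (x : Lam n) :
    ∃ N, ∀ M, N ≤ M → x = ∑ i ∈ Finset.range M, lamProj i x := by
  classical
  obtain ⟨N, hN⟩ := (DirectSum.decompose (fun i : ℕ => ⋀[ℂ]^i (Cot n)) x).support.exists_nat_subset_range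
  refine ⟨N, fun M hM => ?_⟩
  conv_lhs => rw [← DirectSum.sum_support_decompose (fun i : ℕ => ⋀[ℂ]^i (Cot n)) x]
  refine Finset.sum_subset (hN.trans (Finset.range_mono hM)) fun i _ hi => ?_
  simpa using hi

lemma lam_bound (n : ℕ) : ∃ N, ∀ x : Lam n, x = ∑ i ∈ Finset.range N, lamProj i x := by
  set b := Module.finBasis ℂ (Lam n)
  choose N hN using fun i => lam_sum_proj (b i)
  refine ⟨Finset.univ.sup N, fun x => ?_⟩
  have h : (LinearMap.id : Lam n →ₗ[ℂ] Lam n) =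
      ∑ i ∈ Finset.range (Finset.univ.sup N), lamProj i := by
    refine b.ext fun i => ?_
    rw [LinearMap.sum_apply]
    exact hN i _ (Finset.le_sup (Finset.mem_univ i))
  have := LinearMap.congr_fun h x
  rwa [LinearMap.sum_apply] at this

lemma lamProj_pull (A : Cn n →L[ℝ] Cn n) (k : ℕ) (x : Lam n) :
    lamProj k (pull A x) = pull A (lamProj k x) := by
  obtain ⟨N, hN⟩ := lam_sum_proj x
  have h : ∀ i, lamProj k (pull A (lamProj i x)) = pull A (lamProj k (lamProj i x)) := fun i => by
    by_cases h : k = i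
    · subst h; rw [lamProj_same (pull_mem A (lamProj_mem k x)), lamProj_same (lamProj_mem k x)]
    · rw [lamProj_ne h (pull_mem A (lamProj_mem i x)), lamProj_ne h (lamProj_mem i x), map_zero]
  rw [hN N le_rfl]
  simp only [map_sum, h]

/-- a complex-linear map as a continuous real-linear map -/
def realCLM (P : Lam n →ₗ[ℂ] Lam n) : Lam n →L[ℝ] Lam n :=
  P.toContinuousLinearMap.restrictScalars ℝ

/-- the component of degree `k` of a form -/
def formProj (n : ℕ) (X : Type u) [TopologicalSpace X] [ChartedSpace (Cn n) X] (k : ℕ) :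
    Forms n X →+ Forms n X where
  toFun w := ⟨fun e y => lamProj k (w.1 e y),
    fun e => smooth_congr ((realCLM (lamProj k)).contDiff.comp_contDiffOn (w.2.smooth e))
      fun y => by
        change _ = lamProj k (extend e.1.target (w.1 e) y)
        rw [extend_coe],
    fun e e' y hy => by rw [w.2.compat e e' y hy, lamProj_pull]⟩
  map_zero' := Subtype.ext <| funext fun e => funext fun y => map_zero _
  map_add' a b := Subtype.ext <| funext fun e => funext fun y => map_add _ _ _

lemma forms_coe_sum {X : Type u} [TopologicalSpace X] [ChartedSpace (Cn n) X] (s : Finset ℕ)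
    (w : ℕ → Forms n X) (e : atlas (Cn n) X) (y : e.1.target) :
    (∑ i ∈ s, w i).1 e y = ∑ i ∈ s, (w i).1 e y := by
  have h : (∑ i ∈ s, w i).1 = ∑ i ∈ s, (w i).1 := AddSubmonoidClass.coe_finsetSum _ _
  rw [h, Finset.sum_apply, Finset.sum_apply]

instance graded_forms (n : ℕ) (X : Type u) [TopologicalSpace X] [ChartedSpace (Cn n) X] :
    GradedAlgebra (formGrading n X) :=
  gradedOfProj (formGrading n X) (formProj n X) (fun i w e y => lamProj_mem i _)
    (fun i w hw => Subtype.ext <| funext fun e => funext fun y => lamProj_same (hw e y))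
    (fun i j h w hw => Subtype.ext <| funext fun e => funext fun y => lamProj_ne h (hw e y))
    (fun w => by
      obtain ⟨N, hN⟩ := lam_bound n
      refine ⟨N, Subtype.ext <| funext fun e => funext fun y => ?_⟩
      rw [forms_coe_sum]
      exact hN _)

section manifold

variable {X : Type u} [TopologicalSpace X] [ChartedSpace (Cn n) X] [IsManifold 𝓘(ℂ, Cn n) ω X]

lemma dLoc_mem {f : Cn n → Lam n} {y : Cn n} {k : ℕ} (hf : DifferentiableAt ℝ f y)
    (h : ∀ᶠ x in nhds y, f x ∈ ⋀[ℂ]^k (Cot n)) : dLoc f y ∈ ⋀[ℂ]^(k + 1) (Cot n) := by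
  have h1 : f =ᶠ[nhds y] fun x => realCLM (lamProj k) (f x) := by
    filter_upwards [h] with x hx using (lamProj_same hx).symm
  have h2 : fderiv ℝ f y = (realCLM (lamProj k)).comp (fderiv ℝ f y) := by
    conv_lhs => rw [h1.fderiv_eq]
    exact ((realCLM (lamProj k)).hasFDerivAt.comp y hf.hasFDerivAt).fderiv
  have h3 : ∀ v, fderiv ℝ f y v ∈ ⋀[ℂ]^k (Cot n) := fun v => by
    rw [h2]; exact lamProj_mem k _
  rw [dLoc_eq, dLin_sum]
  exact Submodule.sum_mem _ fun a _ => cov_mul_mem _ (h3 _)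

lemma extD_mem {k : ℕ} {w : Forms n X} (hw : w ∈ formGrading n X k) :
    extD n X w ∈ formGrading n X (k + 1) := fun e y => by
  refine dLoc_mem (extend_diff w.2 e y.2) ?_
  filter_upwards [e.1.open_target.mem_nhds y.2] with x hx
  rw [extend_of_mem _ hx]
  exact hw e _

lemma extD_extD (w : Forms n X) : extD n X (extD n X w) = 0 := by
  refine Subtype.ext <| funext fun e => funext fun y => ?_
  have h : extend e.1.target ((extD n X w).1 e) =ᶠ[nhds (y : Cn n)]
      dLoc (extend e.1.target (w.1 e)) := by
    filter_upwards [e.1.open_target.mem_nhds y.2] with x hx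
    rw [extend_of_mem _ hx]; rfl
  exact (dLoc_congr h).trans (dLoc_dLoc (extend_smoothAt w.2 e y.2))

lemma extD_mul {k : ℕ} {a : Forms n X} (ha : a ∈ formGrading n X k) (b : Forms n X) :
    extD n X (a * b) = extD n X a * b + (-1 : ℂ) ^ k • (a * extD n X b) := by
  refine Subtype.ext <| funext fun e => funext fun y => ?_
  have h : extend e.1.target ((a * b).1 e) =ᶠ[nhds (y : Cn n)]
      fun x => extend e.1.target (a.1 e) x * extend e.1.target (b.1 e) x := by
    filter_upwards [e.1.open_target.mem_nhds y.2] with x hx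
    rw [extend_of_mem _ hx, extend_of_mem _ hx, extend_of_mem _ hx]; rfl
  refine (dLoc_congr h).trans ?_
  rw [dLoc_mul (extend_diff a.2 e y.2) (extend_diff b.2 e y.2), extend_coe, extend_coe,
    inv_of_mem (ha e y), smul_mul_assoc]
  rfl

end manifold

/-- The de Rham algebra `(A^•(X), d)` of smooth complex-valued forms on `X`. -/
def deRham (n : ℕ) (X : Type u) [TopologicalSpace X] [ChartedSpace (Cn n) X]
    [IsManifold 𝓘(ℂ, Cn n) ω X] : DGA.{u} where
  carrier := Forms n X
  grading := formGrading n X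
  d := extD n X
  d_mem := extD_mem
  d_d := extD_extD
  leibniz := extD_mul
  comm ha hb := Subtype.ext <| funext fun e => funext fun y => mul_comm_of_mem (ha e y) (hb e y)

end DeformedForms

end

/-!
Contraction with `φ` is a derivation of degree `0` of `A^•(X)`, and its exponential `e^{i_φ}` is an
algebra automorphism that preserves degrees. The Maurer–Cartan equation says that it conjugates the
exterior derivative into `d_φ`, that is `d e^{i_φ} = e^{i_φ} d_φ` (`Beltrami.extD_expForm`): both
`d_φ` and `e^{-i_φ} d e^{i_φ}` are antiderivations, so that they need only be compared on functions,
on `dz̄_j` and on `dz_j`, and on `dz_j` their equality is the Maurer–Cartan equation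
(`conjAt_dz`). Hence `(A^•(X), d_φ)` is a differential graded algebra, isomorphic to the de Rham
algebra, and it suffices to show that it is formal.

On `(A^•(X), d_φ)` the operator `∂` is a second differential, which anticommutes with `d_φ`. The
argument of Deligne, Griffiths, Morgan and Sullivan applies
(`DGA.SecondDifferential.DDeltaLemma.isFormal`): if `ker d_φ ∩ im ∂` and `ker ∂ ∩ im d_φ` are both
contained in `im ∂d_φ`, then the inclusion of `ker ∂` in `(A^•(X), d_φ)` and the projection of
`ker ∂` onto the cohomology of `∂`, with zero differential, are quasi-isomorphisms.

It remains to derive these two inclusions from the `∂∂̄_φ`-lemma, which concerns the image of `d_φ`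
only. If `∂∂̄_φ y = 0`, the lemma places `∂y + ∂̄_φ y` in `im ∂∂̄_φ`. To separate the two summands one
would take components with respect to the bidegree; here pullback along multiplication by `i` on the
tangent spaces plays this role, since it multiplies forms of type `(p,q)` by `i^(p-q)` and so
transforms `∂` and `∂̄_φ` with opposite factors `-i` and `i` (`exists_of_rotation`).
-/

noncomputable section

namespace DeformedForms

/-! ### Quasi-isomorphisms and invariance of formality -/

namespace DGA

namespace Hom

variable {A B : DGA.{u}}

lemma onCohomology_mk (f : Hom A B) (z : A.cocycles) :
    f.onCohomology (Ideal.Quotient.mk A.coboundaries z) =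
      Ideal.Quotient.mk B.coboundaries (f.onCocycles z) := rfl

lemma isQuasiIso_of (f : Hom A B)
    (inj : ∀ x, A.d x = 0 → ∀ y, B.d y = f.toAlgHom x → ∃ w, A.d w = x)
    (surj : ∀ y, B.d y = 0 → ∃ x, A.d x = 0 ∧ ∃ w, B.d w = f.toAlgHom x - y) :
    f.IsQuasiIso := by
  constructor
  · refine (RingHom.injective_iff_ker_eq_bot f.onCohomology).mpr ((eq_bot_iff).mpr fun a ha => ?_)
    rw [RingHom.mem_ker] at ha
    rw [Ideal.mem_bot]
    obtain ⟨z, rfl⟩ := Ideal.Quotient.mk_surjective a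
    rw [onCohomology_mk, Ideal.Quotient.eq_zero_iff_mem] at ha
    obtain ⟨y, hy⟩ := ha
    rw [Ideal.Quotient.eq_zero_iff_mem]
    exact inj z z.2 y hy
  · intro b
    obtain ⟨y, rfl⟩ := Ideal.Quotient.mk_surjective b
    obtain ⟨x, hx, w, hw⟩ := surj y y.2
    refine ⟨Ideal.Quotient.mk A.coboundaries ⟨x, hx⟩, ?_⟩
    rw [onCohomology_mk, Ideal.Quotient.mk_eq_mk_iff_sub_mem]
    exact ⟨w, hw⟩

lemma isQuasiIso_of_bijective (f : Hom A B) (hf : Function.Bijective f.toAlgHom) :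
    f.IsQuasiIso := by
  refine f.isQuasiIso_of (fun x _ y hy => ?_) (fun y hy => ?_)
  · obtain ⟨w, rfl⟩ := hf.2 y
    exact ⟨w, hf.1 (by rw [f.map_d, hy])⟩
  · obtain ⟨x, rfl⟩ := hf.2 y
    exact ⟨x, hf.1 (by rw [f.map_d, hy, map_zero]), 0, by rw [map_zero, sub_self]⟩

/-- The map induced on cohomology, as a homomorphism of differential graded algebras. -/
def cohomologyHom (f : Hom A B) : Hom A.cohomology B.cohomology where
  toAlgHom :=
    { toRingHom := f.onCohomology
      commutes' := fun r => by
        change f.onCohomology (Ideal.Quotient.mk A.coboundaries (algebraMap ℂ A.cocycles r)) =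
          Ideal.Quotient.mk B.coboundaries (algebraMap ℂ B.cocycles r)
        rw [onCohomology_mk, AlgHom.commutes] }
  map_mem := by
    rintro i _ ⟨z, hz, rfl⟩
    exact ⟨f.onCocycles z, f.map_mem hz, rfl⟩
  map_d _ := map_zero f.onCohomology

lemma IsQuasiIso.cohomologyHom {f : Hom A B} (hf : f.IsQuasiIso) : f.cohomologyHom.IsQuasiIso :=
  isQuasiIso_of_bijective _ hf

end Hom

/-- The projection of a differential graded algebra with zero differential onto its cohomology. -/
def toCohomology (A : DGA.{u}) (h : ∀ x, A.d x = 0) : Hom A A.cohomology where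
  toAlgHom := (Ideal.Quotient.mkₐ ℂ A.coboundaries).comp
    ((AlgHom.id ℂ A.carrier).codRestrict A.cocycles h)
  map_mem {_ x} hx := ⟨⟨x, h x⟩, hx, rfl⟩
  map_d x := by
    have h0 : A.d x = 0 := h x
    rw [h0]
    exact map_zero _

lemma toCohomology_isQuasiIso (A : DGA.{u}) (h : ∀ x, A.d x = 0) :
    (A.toCohomology h).IsQuasiIso := by
  refine Hom.isQuasiIso_of_bijective _ ⟨?_, fun b => ?_⟩
  · rw [injective_iff_map_eq_zero]
    intro x hx
    obtain ⟨y, hy⟩ := Ideal.Quotient.eq_zero_iff_mem.mp hx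
    exact hy.symm.trans (h y)
  · obtain ⟨z, rfl⟩ := Ideal.Quotient.mk_surjective b
    exact ⟨z, rfl⟩

lemma isFormal_of_d_eq_zero (A : DGA.{u}) (h : ∀ x, A.d x = 0) : A.IsFormal :=
  .rel _ _ ⟨_, A.toCohomology_isQuasiIso h⟩

lemma IsFormal.of_eqvGen {A B : DGA.{u}} (hA : A.IsFormal)
    (h : Relation.EqvGen (fun C D : DGA.{u} => ∃ f : Hom C D, f.IsQuasiIso) A B) :
    B.IsFormal := by
  have hcoh : Relation.EqvGen (fun C D : DGA.{u} => ∃ f : Hom C D, f.IsQuasiIso)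
      A.cohomology B.cohomology := by
    clear hA
    induction h with
    | rel _ _ hf => exact .rel _ _ ⟨_, hf.choose_spec.cohomologyHom⟩
    | refl _ => exact .refl _
    | symm _ _ _ ih => exact .symm _ _ ih
    | trans _ _ _ _ _ ih₁ ih₂ => exact .trans _ _ _ ih₁ ih₂
  exact .trans _ _ _ (.symm _ _ h) (.trans _ _ _ hA hcoh)

/-! ### Formality from a second differential -/

/-- A second differential on a differential graded algebra, of degree `1` and anticommuting with
the given one. -/
structure SecondDifferential (A : DGA.{u}) where
  δ : A.carrier →ₗ[ℂ] A.carrier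
  δ_mem : ∀ {i x}, x ∈ A.grading i → δ x ∈ A.grading (i + 1)
  δ_δ : ∀ x, δ (δ x) = 0
  leibniz : ∀ {i x}, x ∈ A.grading i → ∀ y, δ (x * y) = δ x * y + (-1 : ℂ) ^ i • (x * δ y)
  anticomm : ∀ x, A.d (δ x) = -δ (A.d x)

namespace SecondDifferential

variable {A : DGA.{u}} (D : SecondDifferential A)

/-- The algebra `A` with the differential `δ` instead of `d`. -/
abbrev toDGA : DGA.{u} where
  carrier := A.carrier
  grading := A.grading
  d := D.δ
  d_mem := D.δ_mem
  d_d := D.δ_δ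
  leibniz := D.leibniz
  comm := A.comm

/-- The elements of degree `i` of `ker δ`. -/
def kerGrading (i : ℕ) : Submodule ℂ D.toDGA.cocycles :=
  (A.grading i).comap D.toDGA.cocycles.val.toLinearMap

instance gradedMonoid_ker : SetLike.GradedMonoid D.kerGrading where
  one_mem := show (1 : A.carrier) ∈ A.grading 0 from SetLike.GradedOne.one_mem
  mul_mem i j a b ha hb :=
    show (a.1 * b.1 : A.carrier) ∈ A.grading (i + j) from SetLike.GradedMul.mul_mem ha hb

instance graded_ker : GradedAlgebra D.kerGrading :=
  gradedOfProj D.kerGrading D.toDGA.projCocycles (fun i z => D.toDGA.proj_mem i z)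
    (fun _ _ hz => Subtype.ext (D.toDGA.proj_same hz))
    (fun _ _ h _ hz => Subtype.ext (D.toDGA.proj_ne h hz))
    (fun z => by
      obtain ⟨N, hN⟩ := D.toDGA.sum_proj z
      refine ⟨N, Subtype.ext ((hN N le_rfl).trans ?_)⟩
      rw [AddSubmonoidClass.coe_finsetSum]
      rfl)

/-- The differential graded subalgebra `ker δ` of `A`. -/
abbrev ker : DGA.{u} where
  carrier := D.toDGA.cocycles
  grading := D.kerGrading
  d := (A.d ∘ₗ D.toDGA.cocycles.val.toLinearMap).codRestrict
    (Subalgebra.toSubmodule D.toDGA.cocycles) fun z => by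
      change D.δ (A.d z) = 0
      have hz : D.δ z = 0 := z.2
      rw [← neg_eq_zero, ← D.anticomm, hz, map_zero]
  d_mem hx := A.d_mem hx
  d_d x := Subtype.ext (A.d_d _)
  leibniz hx y := Subtype.ext (A.leibniz hx _)
  comm hx hy := Subtype.ext (A.comm hx hy)

/-- The inclusion of `ker δ` into `A`. -/
def kerIncl : Hom D.ker A where
  toAlgHom := D.toDGA.cocycles.val
  map_mem hx := hx
  map_d _ := rfl

/-- The `dδ`-lemma, in the form `ker d ∩ im δ ⊆ im δd` and `ker δ ∩ im d ⊆ im δd`. -/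
structure DDeltaLemma : Prop where
  im_δ : ∀ y, A.d (D.δ y) = 0 → ∃ w, D.δ (A.d w) = D.δ y
  im_d : ∀ y, D.δ (A.d y) = 0 → ∃ w, D.δ (A.d w) = A.d y

variable {D}

lemma DDeltaLemma.exists_of_mem_ker (h : D.DDeltaLemma) {z : A.carrier} (hz : D.δ z = 0) :
    ∃ w, D.δ (A.d w) = A.d z :=
  h.im_d z (by rw [← neg_eq_zero, ← D.anticomm, hz, map_zero])

lemma kerIncl_isQuasiIso (h : D.DDeltaLemma) : D.kerIncl.IsQuasiIso := by
  refine Hom.isQuasiIso_of _ (fun x _ y hy => ?_) (fun y hy => ?_)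
  · have hx : D.δ x.1 = 0 := x.2
    have hy : A.d y = x.1 := hy
    obtain ⟨w, hw⟩ := h.im_d y (by rw [hy, hx])
    refine ⟨⟨-D.δ w, ?_⟩, Subtype.ext ?_⟩
    · change D.δ (-D.δ w) = 0
      rw [map_neg, D.δ_δ, neg_zero]
    · change A.d (-D.δ w) = x.1
      rw [map_neg, D.anticomm, neg_neg, hw, hy]
  · obtain ⟨w, hw⟩ := h.im_δ y (by rw [D.anticomm, hy, map_zero, neg_zero])
    refine ⟨⟨y - A.d w, ?_⟩, Subtype.ext ?_, -w, ?_⟩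
    · change D.δ (y - A.d w) = 0
      rw [map_sub, hw, sub_self]
    · change A.d (y - A.d w) = 0
      rw [map_sub, A.d_d, hy, sub_zero]
    · change A.d (-w) = y - A.d w - y
      rw [map_neg]
      abel

/-- On the cohomology of `δ` the differential induced by `d` is zero: for `z ∈ ker δ`, the element
`d z` lies in `ker δ ∩ im d`. -/
def kerProj (h : D.DDeltaLemma) : Hom D.ker D.toDGA.cohomology where
  toAlgHom := Ideal.Quotient.mkₐ ℂ D.toDGA.coboundaries
  map_mem {_ x} hx := ⟨x, hx, rfl⟩
  map_d z := by
    obtain ⟨w, hw⟩ := h.exists_of_mem_ker (z := z.1) z.2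
    exact Ideal.Quotient.eq_zero_iff_mem.mpr ⟨A.d w, hw⟩

lemma kerProj_isQuasiIso (h : D.DDeltaLemma) : (kerProj h).IsQuasiIso := by
  refine Hom.isQuasiIso_of _ (fun x hx y hy => ?_) (fun y _ => ?_)
  · obtain ⟨v, hv⟩ := Ideal.Quotient.eq_zero_iff_mem.mp hy.symm
    have hv : D.δ v = x.1 := hv
    have hx : A.d x.1 = 0 := congrArg Subtype.val hx
    obtain ⟨w, hw⟩ := h.im_δ v (by rw [hv, hx])
    refine ⟨⟨-D.δ w, ?_⟩, Subtype.ext ?_⟩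
    · change D.δ (-D.δ w) = 0
      rw [map_neg, D.δ_δ, neg_zero]
    · change A.d (-D.δ w) = x.1
      rw [map_neg, D.anticomm, neg_neg, hw, hv]
  · obtain ⟨z, rfl⟩ := Ideal.Quotient.mk_surjective y
    obtain ⟨w, hw⟩ := h.exists_of_mem_ker (z := z.1) z.2
    have hz : D.δ z.1 = 0 := z.2
    have hmem : D.δ (z.1 + D.δ w) = 0 := by rw [map_add, hz, D.δ_δ, add_zero]
    refine ⟨⟨z.1 + D.δ w, hmem⟩, Subtype.ext ?_, 0, ?_⟩
    · change A.d (z.1 + D.δ w) = 0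
      rw [map_add, D.anticomm, hw, add_neg_cancel]
    · have hcob : (⟨z.1 + D.δ w, hmem⟩ : D.toDGA.cocycles) - z ∈ D.toDGA.coboundaries :=
        ⟨w, by change D.δ w = z.1 + D.δ w - z.1; abel⟩
      exact (sub_eq_zero.mpr (Ideal.Quotient.eq.mpr hcob)).symm

/-- The `dδ`-lemma implies formality, through `A ← ker δ → H_δ(A)`. -/
theorem DDeltaLemma.isFormal (h : D.DDeltaLemma) : A.IsFormal :=
  (isFormal_of_d_eq_zero D.toDGA.cohomology fun _ => rfl).of_eqvGen <|
    .trans _ D.ker _ (.symm _ _ (.rel _ _ ⟨_, kerProj_isQuasiIso h⟩))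
      (.rel _ _ ⟨_, kerIncl_isQuasiIso h⟩)

end SecondDifferential

end DGA

variable {n : ℕ}

/-! ### The exponential of a contraction -/

/-- `tz A` as a complex-linear map on covectors. -/
def tzLin (A : Cn n →L[ℝ] Cn n) : Cot n →ₗ[ℂ] Cot n where
  toFun := tz A
  map_add' α β := by
    ext v
    simp only [add_apply, tz_apply]
    ring
  map_smul' c α := by
    ext v
    simp only [smul_apply, tz_apply, smul_eq_mul, RingHom.id_apply]
    ring

/-- The automorphism `e^{i_A}` of the exterior algebra, for a conjugate-linear `A`. On covectors it
is `α ↦ α + i_A α`, since `i_A` is a derivation that vanishes on the covectors `i_A α` of type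
`(0,1)`. -/
def expContr (A : Cn n →L[ℝ] Cn n) : Lam n →ₐ[ℂ] Lam n :=
  ExteriorAlgebra.map (LinearMap.id + tzLin A)

lemma expContr_cov (A : Cn n →L[ℝ] Cn n) (α : Cot n) :
    expContr A (cov α) = cov α + cov (tz A α) :=
  (ExteriorAlgebra.map_apply_ι _ _).trans (map_add _ _ _)

lemma tz_tz_neg {A : Cn n →L[ℝ] Cn n} (hA : ∀ v, A (Complex.I • v) = -(Complex.I • A v))
    (B : Cn n →L[ℝ] Cn n) (α : Cot n) : tz B (tz A α) = 0 := by
  ext v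
  have h : ∀ w : Cn n, α (Complex.I • Complex.I • w) = - α w := fun w => by
    rw [smul_smul, Complex.I_mul_I, neg_one_smul, map_neg]
  simp only [tz_apply, hA, smul_neg, map_neg, h, zero_apply]
  linear_combination (1 / 4 : ℂ) * (α (A (B v))) * Complex.I_mul_I

lemma tz_neg (A : Cn n →L[ℝ] Cn n) (α : Cot n) : tz (-A) α = -tz A α := by
  ext v
  simp only [tz_apply, neg_apply, smul_neg, map_neg]
  ring

lemma expContr_neg {A : Cn n →L[ℝ] Cn n} (hA : ∀ v, A (Complex.I • v) = -(Complex.I • A v))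
    (x : Lam n) : expContr (-A) (expContr A x) = x := by
  have : (expContr (-A)).comp (expContr A) = AlgHom.id ℂ (Lam n) := by
    apply ExteriorAlgebra.hom_ext
    ext α : 1
    change expContr (-A) (expContr A (cov α)) = cov α
    rw [expContr_cov, map_add, expContr_cov, expContr_cov, tz_tz_neg hA, tz_neg]
    simp only [cov, map_neg, map_zero]
    abel
  exact DFunLike.congr_fun this x

lemma expContr_neg' {A : Cn n →L[ℝ] Cn n} (hA : ∀ v, A (Complex.I • v) = -(Complex.I • A v))
    (x : Lam n) : expContr A (expContr (-A) x) = x := by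
  have h := expContr_neg (A := -A) (fun v => by simp only [neg_apply, hA, smul_neg]) x
  rwa [neg_neg] at h

lemma expContr_pull {A A' B : Cn n →L[ℝ] Cn n} (hB : ∀ v, B (Complex.I • v) = Complex.I • B v)
    (h : ∀ v, A' (B v) = B (A v)) (x : Lam n) :
    expContr A (pull B x) = pull B (expContr A' x) := by
  have : (expContr A).comp (pull B) = (pull B).comp (expContr A') := by
    apply ExteriorAlgebra.hom_ext
    ext α : 1
    change expContr A (pull B (cov α)) = pull B (expContr A' (cov α))
    rw [pull_cov, expContr_cov, expContr_cov, map_add, pull_cov, pull_cov]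
    congr 2
    ext v
    simp only [ContinuousLinearMap.comp_apply, tz_apply, h, hB]
  exact DFunLike.congr_fun this x

lemma inv_expContr (A : Cn n →L[ℝ] Cn n) (x : Lam n) :
    inv (expContr A x) = expContr A (inv x) := by
  have : (inv : Lam n →ₐ[ℂ] Lam n).comp (expContr A) = (expContr A).comp inv := by
    apply ExteriorAlgebra.hom_ext
    ext α : 1
    change inv (expContr A (cov α)) = expContr A (inv (cov α))
    rw [expContr_cov, map_add, inv_cov, inv_cov, map_neg, expContr_cov, neg_add]
  exact DFunLike.congr_fun this x

lemma expContr_mem (A : Cn n →L[ℝ] Cn n) {k : ℕ} {x : Lam n} (hx : x ∈ ⋀[ℂ]^k (Cot n)) :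
    expContr A x ∈ ⋀[ℂ]^k (Cot n) := by
  induction hx using Submodule.pow_induction_on_left' with
  | algebraMap r =>
    rw [AlgHom.commutes]
    exact (pow_zero (LinearMap.range (ExteriorAlgebra.ι ℂ : Cot n →ₗ[ℂ] Lam n))).ge
      (Submodule.algebraMap_mem r)
  | add x y i hx hy h1 h2 => rw [map_add]; exact Submodule.add_mem _ h1 h2
  | mem_mul m hm i x hx h =>
    obtain ⟨α, rfl⟩ := hm
    rw [map_mul, Nat.succ_eq_add_one, ext_succ]
    exact Submodule.mul_mem_mul ⟨_, ExteriorAlgebra.map_apply_ι _ α |>.symm⟩ h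

/-- `A ↦ tz A α` as a continuous linear map -/
def tzL (α : Cot n) : (Cn n →L[ℝ] Cn n) →L[ℝ] Cot n :=
  LinearMap.toContinuousLinearMap
    { toFun := fun A => tz A α
      map_add' := fun A B => by
        ext v
        simp only [add_apply, tz_apply, smul_add, map_add]
        ring
      map_smul' := fun c A => by
        ext v
        simp only [smul_apply, tz_apply, smul_comm Complex.I c, map_smul, RingHom.id_apply,
          Complex.real_smul]
        ring }

/-- The inclusion of covectors, as a continuous real-linear map. -/
def covL : Cot n →L[ℝ] Lam n :=
  (ExteriorAlgebra.ι ℂ : Cot n →ₗ[ℂ] Lam n).toContinuousLinearMap.restrictScalars ℝ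

lemma contDiff_mul {E : Type*} [NormedAddCommGroup E] [NormedSpace ℝ E] {f g : E → Lam n}
    (hf : ContDiff ℝ ∞ f) (hg : ContDiff ℝ ∞ g) : ContDiff ℝ ∞ fun x => f x * g x :=
  (mulL (n := n)).isBoundedBilinearMap.contDiff.comp (hf.prodMk hg)

lemma contDiff_expContr_const (x : Lam n) :
    ContDiff ℝ ∞ fun A : Cn n →L[ℝ] Cn n => expContr A x := by
  induction x using ExteriorAlgebra.induction with
  | algebraMap r => simp only [AlgHom.commutes]; exact contDiff_const
  | ι α =>
    have : (fun A : Cn n →L[ℝ] Cn n => expContr A (ExteriorAlgebra.ι ℂ α)) =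
        fun A => cov α + covL (tzL α A) := funext fun A => expContr_cov A α
    rw [this]
    exact contDiff_const.add (covL.contDiff.comp (tzL α).contDiff)
  | mul a b ha hb =>
    simp only [map_mul]
    exact contDiff_mul ha hb
  | add a b ha hb => simp only [map_add]; exact ha.add hb

lemma contDiff_expContr :
    ContDiff ℝ ∞ fun p : (Cn n →L[ℝ] Cn n) × Lam n => expContr p.1 p.2 := by
  set b := Module.finBasis ℂ (Lam n)
  have h : (fun p : (Cn n →L[ℝ] Cn n) × Lam n => expContr p.1 p.2) =
      fun p => ∑ i, algebraMap ℂ (Lam n) (b.repr p.2 i) * expContr p.1 (b i) := by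
    funext p
    conv_lhs => rw [← b.sum_repr p.2]
    simp only [map_sum, map_smul]
    exact Finset.sum_congr rfl fun i _ => Algebra.smul_def _ _
  rw [h]
  refine ContDiff.sum fun i _ => contDiff_mul ?_
    ((contDiff_expContr_const (b i)).comp contDiff_fst)
  exact (((Algebra.linearMap ℂ (Lam n)).comp (b.coord i)).toContinuousLinearMap.restrictScalars
    ℝ).contDiff.comp contDiff_snd

/-! ### Leibniz rules -/

lemma delLin_leibniz (a b : Lam n) (f' g' : Cn n →L[ℝ] Lam n) :
    delLin ((mulL.precompR (Cn n)) a g' + (mulL.precompL (Cn n)) f' b)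
      = delLin f' * b + inv a * delLin g' := by
  have h : ∀ v, ((mulL.precompR (Cn n)) a g' + (mulL.precompL (Cn n)) f' b) v
      = a * g' v + f' v * b := fun v => rfl
  simp only [delLin, Finset.sum_mul, Finset.mul_sum, ← Finset.sum_add_distrib]
  refine Finset.sum_congr rfl fun j _ => ?_
  have h1 : evalZ ((mulL.precompR (Cn n)) a g' + (mulL.precompL (Cn n)) f' b) j =
      a * evalZ g' j + evalZ f' j * b := by
    simp only [evalZ, h, mul_smul_comm, smul_mul_assoc, mul_sub, sub_mul]
    module
  rw [h1, mul_add, ← mul_assoc, ← mul_assoc, ← mul_assoc, cov_mul _ a]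
  abel

lemma delLoc_mul {f g : Cn n → Lam n} {y : Cn n} (hf : DifferentiableAt ℝ f y)
    (hg : DifferentiableAt ℝ g y) :
    delLoc (fun x => f x * g x) y = delLoc f y * g y + inv (f y) * delLoc g y := by
  rw [delLoc, delLoc, delLoc, (hasFDerivAt_mul hf.hasFDerivAt hg.hasFDerivAt).fderiv,
    delLin_leibniz]

lemma inv_contr (A : Cn n →L[ℝ] Cn n) (x : Lam n) : inv (contr A x) = contr A (inv x) := by
  induction x using ExteriorAlgebra.induction with
  | algebraMap r => rw [AlgHom.commutes, contr_algebraMap, map_zero]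
  | ι α =>
    change inv (contr A (cov α)) = contr A (inv (cov α))
    rw [inv_cov, contr_cov, inv_cov, ← neg_one_smul ℂ (cov α), contr_smul_right, contr_cov,
      neg_one_smul]
  | mul x y hx hy => rw [contr_mul, map_add, map_mul, map_mul, map_mul, contr_mul, hx, hy]
  | add x y hx hy => rw [contr_add_right, map_add, hx, hy, map_add, contr_add_right]

/-- `d_φ η = dη - i_φ ∂η + ∂ i_φ η` on `ℂⁿ`. -/
def dPhiLoc (A : Cn n → Cn n →L[ℝ] Cn n) (f : Cn n → Lam n) (y : Cn n) : Lam n :=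
  dLoc f y - contr (A y) (delLoc f y) + delLoc (fun x => contr (A x) (f x)) y

variable {A : Cn n → Cn n →L[ℝ] Cn n} {y : Cn n}

lemma differentiableAt_contr {f : Cn n → Lam n} (hA : DifferentiableAt ℝ A y)
    (hf : DifferentiableAt ℝ f y) : DifferentiableAt ℝ (fun x => contr (A x) (f x)) y :=
  ((contrL (n := n)).hasFDerivAt_of_bilinear hA.hasFDerivAt hf.hasFDerivAt).differentiableAt

lemma differentiableAt_expContr {f : Cn n → Lam n} (hA : DifferentiableAt ℝ A y)
    (hf : DifferentiableAt ℝ f y) : DifferentiableAt ℝ (fun x => expContr (A x) (f x)) y := by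
  have key : ∀ F : (Cn n →L[ℝ] Cn n) × Lam n → Lam n, Differentiable ℝ F →
      DifferentiableAt ℝ (fun x => F (A x, f x)) y := fun F hF =>
    (hF (A y, f y)).comp y (hA.prodMk hf)
  exact key _ (contDiff_expContr.differentiable (by simp))

lemma dPhiLoc_mul {f g : Cn n → Lam n} (hA : DifferentiableAt ℝ A y)
    (hf : DifferentiableAt ℝ f y) (hg : DifferentiableAt ℝ g y) :
    dPhiLoc A (fun x => f x * g x) y = dPhiLoc A f y * g y + inv (f y) * dPhiLoc A g y := by
  have hif := differentiableAt_contr hA hf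
  have hig := differentiableAt_contr hA hg
  have h1 : delLoc (fun x => contr (A x) (f x * g x)) y =
      delLoc (fun x => contr (A x) (f x) * g x) y +
        delLoc (fun x => f x * contr (A x) (g x)) y := by
    rw [← localOp_del.add (hasFDerivAt_mul hif.hasFDerivAt hg.hasFDerivAt).differentiableAt
      (hasFDerivAt_mul hf.hasFDerivAt hig.hasFDerivAt).differentiableAt]
    simp only [contr_mul]
  rw [dPhiLoc, h1, dLoc_mul hf hg, delLoc_mul hf hg, delLoc_mul hif hg, delLoc_mul hf hig,
    contr_add_right, contr_mul, contr_mul, inv_contr, dPhiLoc, dPhiLoc]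
  noncomm_ring

lemma dPhiLoc_add {f g : Cn n → Lam n} (hA : DifferentiableAt ℝ A y)
    (hf : DifferentiableAt ℝ f y) (hg : DifferentiableAt ℝ g y) :
    dPhiLoc A (fun x => f x + g x) y = dPhiLoc A f y + dPhiLoc A g y := by
  simp only [dPhiLoc, contr_add_right]
  rw [localOp_d.add hf hg, localOp_del.add hf hg,
    localOp_del.add (differentiableAt_contr hA hf) (differentiableAt_contr hA hg),
    contr_add_right]
  abel

/-! ### The conjugation formula `d ∘ e^{i_φ} = e^{i_φ} ∘ d_φ` -/

/-- The formula `d e^{i_φ} η = e^{i_φ} d_φ η`, for a given form at a given point. -/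
def ConjAt (A : Cn n → Cn n →L[ℝ] Cn n) (y : Cn n) (f : Cn n → Lam n) : Prop :=
  DifferentiableAt ℝ f y ∧
  dLoc (fun x => expContr (A x) (f x)) y = expContr (A y) (dPhiLoc A f y)

lemma conjAt_add {f g : Cn n → Lam n} (hA : DifferentiableAt ℝ A y) (hf : ConjAt A y f)
    (hg : ConjAt A y g) : ConjAt A y (fun x => f x + g x) := by
  refine ⟨hf.1.add hg.1, ?_⟩
  simp only [map_add]
  rw [localOp_d.add (differentiableAt_expContr hA hf.1) (differentiableAt_expContr hA hg.1), hf.2,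
    hg.2, dPhiLoc_add hA hf.1 hg.1, map_add]

lemma conjAt_mul {f g : Cn n → Lam n} (hA : DifferentiableAt ℝ A y) (hf : ConjAt A y f)
    (hg : ConjAt A y g) : ConjAt A y (fun x => f x * g x) := by
  refine ⟨(hasFDerivAt_mul hf.1.hasFDerivAt hg.1.hasFDerivAt).differentiableAt, ?_⟩
  simp only [map_mul]
  rw [dLoc_mul (differentiableAt_expContr hA hf.1) (differentiableAt_expContr hA hg.1), hf.2,
    hg.2, dPhiLoc_mul hA hf.1 hg.1, map_add, map_mul, map_mul, inv_expContr]

lemma tz_dz (B : Cn n →L[ℝ] Cn n) (j : Fin n) : tz B (dz j) = (dz j).comp B := by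
  ext v
  rw [tz_apply]
  simp only [dz_apply, PiLp.smul_apply, smul_eq_mul, ContinuousLinearMap.comp_apply]
  linear_combination (-1 / 2 : ℂ) * (B v j) * Complex.I_mul_I

lemma tz_dzbar (B : Cn n →L[ℝ] Cn n) (j : Fin n) : tz B (dzbar j) = 0 := by
  ext v
  rw [tz_apply]
  simp only [dzbar_apply, PiLp.smul_apply, smul_eq_mul, map_mul, Complex.conj_I, zero_apply]
  linear_combination (1 / 2 : ℂ) * (starRingEnd ℂ (B v j)) * Complex.I_mul_I

lemma expContr_dz (B : Cn n →L[ℝ] Cn n) (j : Fin n) :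
    expContr B (cov (dz j)) = cov (dz j) + cov ((dz j).comp B) := by
  rw [expContr_cov, tz_dz]

lemma expContr_dzbar (B : Cn n →L[ℝ] Cn n) (j : Fin n) :
    expContr B (cov (dzbar j)) = cov (dzbar j) := by
  rw [expContr_cov, tz_dzbar]
  simp only [cov, map_zero, add_zero]

lemma localOp_zero {T : (Cn n → Lam n) → Cn n → Lam n} (hT : LocalOp T) (y : Cn n) :
    T (fun _ => 0) y = 0 := by
  have h := hT.smul 0 (f := fun _ => (0 : Lam n)) (y := y) (differentiableAt_const _)
  simpa using h

lemma dLoc_const (c : Lam n) (y : Cn n) : dLoc (fun _ => c) y = 0 := by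
  rw [dLoc_eq, fderiv_fun_const]
  simp [dLin]

lemma delLoc_const (c : Lam n) (y : Cn n) : delLoc (fun _ => c) y = 0 := by
  rw [delLoc, fderiv_fun_const]
  simp [delLin, evalZ]

lemma hasFDerivAt_algebraMap {u : Cn n → ℂ} (hu : DifferentiableAt ℝ u y) :
    HasFDerivAt (fun x => algebraMap ℂ (Lam n) (u x))
      ((Algebra.linearMap ℂ (Lam n)).toContinuousLinearMap.restrictScalars ℝ ∘L fderiv ℝ u y) y :=
  ((Algebra.linearMap ℂ (Lam n)).toContinuousLinearMap.restrictScalars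
      ℝ).hasFDerivAt.comp y hu.hasFDerivAt

lemma delLoc_algebraMap {u : Cn n → ℂ} (hu : DifferentiableAt ℝ u y) :
    delLoc (fun x => algebraMap ℂ (Lam n) (u x)) y = ∑ j, evalZ (fderiv ℝ u y) j • cov (dz j) := by
  rw [delLoc, (hasFDerivAt_algebraMap hu).fderiv, delLin]
  refine Finset.sum_congr rfl fun j _ => ?_
  have h : ∀ v, ((Algebra.linearMap ℂ (Lam n)).toContinuousLinearMap.restrictScalars ℝ ∘L
      fderiv ℝ u y) v = algebraMap ℂ (Lam n) (fderiv ℝ u y v) := fun v => rfl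
  have h1 : evalZ ((Algebra.linearMap ℂ (Lam n)).toContinuousLinearMap.restrictScalars ℝ ∘L
      fderiv ℝ u y) j = algebraMap ℂ (Lam n) (evalZ (fderiv ℝ u y) j) := by
    simp only [evalZ, h, map_sub, smul_eq_mul, Algebra.smul_def, map_mul]
  rw [h1, Algebra.smul_def, Algebra.commutes]

lemma delbarLoc_algebraMap {u : Cn n → ℂ} (hu : DifferentiableAt ℝ u y) :
    delbarLoc (fun x => algebraMap ℂ (Lam n) (u x)) y =
      ∑ j, evalZbar (fderiv ℝ u y) j • cov (dzbar j) := by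
  rw [delbarLoc, (hasFDerivAt_algebraMap hu).fderiv, delbarLin]
  refine Finset.sum_congr rfl fun j _ => ?_
  have h : ∀ v, ((Algebra.linearMap ℂ (Lam n)).toContinuousLinearMap.restrictScalars ℝ ∘L
      fderiv ℝ u y) v = algebraMap ℂ (Lam n) (fderiv ℝ u y v) := fun v => rfl
  have h1 : evalZbar ((Algebra.linearMap ℂ (Lam n)).toContinuousLinearMap.restrictScalars ℝ ∘L
      fderiv ℝ u y) j = algebraMap ℂ (Lam n) (evalZbar (fderiv ℝ u y) j) := by
    simp only [evalZbar, h, map_add, smul_eq_mul, Algebra.smul_def, map_mul]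
  rw [h1, Algebra.smul_def, Algebra.commutes]

lemma conjAt_scalar {u : Cn n → ℂ} (hA : ∀ v, A y (Complex.I • v) = -(Complex.I • A y v))
    (hu : DifferentiableAt ℝ u y) : ConjAt A y (fun x => algebraMap ℂ (Lam n) (u x)) := by
  refine ⟨(hasFDerivAt_algebraMap hu).differentiableAt, ?_⟩
  simp only [dPhiLoc, AlgHom.commutes, contr_algebraMap, delLoc_const, add_zero, dLoc,
    delLoc_algebraMap hu, delbarLoc_algebraMap hu]
  have h1 : contr (A y) (∑ j, evalZ (fderiv ℝ u y) j • cov (dz j)) =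
      ∑ j, evalZ (fderiv ℝ u y) j • cov ((dz j).comp (A y)) := by
    have : ∀ x, contr (A y) x = contrL (A y) x := fun _ => rfl
    rw [this, map_sum]
    refine Finset.sum_congr rfl fun j _ => ?_
    rw [contrL_apply, contr_smul_right, contr_cov, tz_dz]
  have h2 : ∀ j, expContr (A y) (cov ((dz j).comp (A y))) = cov ((dz j).comp (A y)) := fun j => by
    rw [expContr_cov, ← tz_dz, tz_tz_neg hA]
    simp only [cov, map_zero, add_zero]
  rw [h1, map_sub, map_add, map_sum, map_sum, map_sum]
  simp only [map_smul, expContr_dz, expContr_dzbar, h2, smul_add, Finset.sum_add_distrib]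
  abel

lemma conjAt_dzbar (j : Fin n) : ConjAt A y (fun _ => cov (dzbar j)) := by
  refine ⟨differentiableAt_const _, ?_⟩
  have h : ∀ x, contr (A x) (cov (dzbar j)) = 0 := fun x => by
    rw [contr_cov, tz_dzbar, cov, map_zero]
  simp only [dPhiLoc, expContr_dzbar, h, dLoc_const, delLoc_const]
  rw [← map_zero (algebraMap ℂ (Lam n)), contr_algebraMap]
  simp

/-- The covector `dz_j ∘ B`, for a conjugate-linear `B`, has type `(0,1)`. -/
lemma dz_comp_eq {B : Cn n →L[ℝ] Cn n} (hB : ∀ v, B (Complex.I • v) = -(Complex.I • B v))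
    (j : Fin n) : (dz j).comp B = ∑ k, B (vecE k) j • dzbar k := by
  conv_lhs => rw [cot_decomp ((dz j).comp B)]
  refine Finset.sum_congr rfl fun k _ => ?_
  have h1 : evalZ ((dz j).comp B) k = 0 := by
    simp only [evalZ, ContinuousLinearMap.comp_apply, hB, dz_apply, PiLp.neg_apply,
      PiLp.smul_apply, smul_eq_mul]
    linear_combination (1 / 2 : ℂ) * B (vecE k) j * Complex.I_mul_I
  have h2 : evalZbar ((dz j).comp B) k = B (vecE k) j := by
    simp only [evalZbar, ContinuousLinearMap.comp_apply, hB, dz_apply, PiLp.neg_apply,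
      PiLp.smul_apply, smul_eq_mul]
    linear_combination -(1 / 2 : ℂ) * B (vecE k) j * Complex.I_mul_I
  rw [h1, h2, zero_smul, zero_add]

/-- The Maurer–Cartan equation, at a point, for a field of conjugate-linear maps. -/
def MCAt (A : Cn n → Cn n →L[ℝ] Cn n) (y : Cn n) : Prop :=
  ∀ i j k : Fin n,
    evalZbar (fderiv ℝ (fun x => A x (vecE k) i) y) j -
        evalZbar (fderiv ℝ (fun x => A x (vecE j) i) y) k =
      ∑ l, (A y (vecE j) l * evalZ (fderiv ℝ (fun x => A x (vecE k) i) y) l -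
        A y (vecE k) l * evalZ (fderiv ℝ (fun x => A x (vecE j) i) y) l)

lemma localOp_sum {T : (Cn n → Lam n) → Cn n → Lam n} (hT : LocalOp T) {ι : Type*}
    (s : Finset ι) {f : ι → Cn n → Lam n} (hf : ∀ i, DifferentiableAt ℝ (f i) y) :
    T (fun x => ∑ i ∈ s, f i x) y = ∑ i ∈ s, T (f i) y := by
  classical
  induction s using Finset.induction_on with
  | empty => simpa using localOp_zero hT y
  | insert i s hi h =>
    simp only [Finset.sum_insert hi]
    rw [hT.add (hf i) (DifferentiableAt.fun_sum fun i _ => hf i), h]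

lemma delbarLoc_mul_const {f : Cn n → Lam n} (hf : DifferentiableAt ℝ f y) (c : Lam n) :
    delbarLoc (fun x => f x * c) y = delbarLoc f y * c := by
  have hc : DifferentiableAt ℝ (fun _ : Cn n => c) y := differentiableAt_const _
  simp only [delbarLoc_eq]
  rw [dLoc_mul hf hc, delLoc_mul hf hc, dLoc_const, delLoc_const]
  noncomm_ring

/-- On `dz_j` the conjugation formula is `∂̄φ^j = i_φ ∂φ^j`, the Maurer–Cartan equation. -/
lemma conjAt_dz (hA : DifferentiableAt ℝ A y)
    (hconj : ∀ᶠ x in nhds y, ∀ v, A x (Complex.I • v) = -(Complex.I • A x v))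
    (hMC : MCAt A y) (j : Fin n) : ConjAt A y (fun _ => cov (dz j)) := by
  refine ⟨differentiableAt_const _, ?_⟩
  have hc : ∀ k, DifferentiableAt ℝ (fun x => A x (vecE k) j) y := fun k =>
    ((dz j).differentiableAt.comp y (hA.clm_apply (differentiableAt_const (vecE k))))
  have hphi : (fun x => cov ((dz j).comp (A x))) =ᶠ[nhds y]
      fun x => ∑ k, algebraMap ℂ (Lam n) (A x (vecE k) j) * cov (dzbar k) := by
    filter_upwards [hconj] with x hx
    rw [dz_comp_eq hx, cov, map_sum]
    exact Finset.sum_congr rfl fun k _ => by rw [map_smul, Algebra.smul_def]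
  have hd : ∀ k, DifferentiableAt ℝ
      (fun x => algebraMap ℂ (Lam n) (A x (vecE k) j) * cov (dzbar k)) y := fun k =>
    (hasFDerivAt_mul (hasFDerivAt_algebraMap (hc k))
      (hasFDerivAt_const (cov (dzbar k)) y)).differentiableAt
  have hphid : DifferentiableAt ℝ (fun x => cov ((dz j).comp (A x))) y :=
    (DifferentiableAt.fun_sum fun k _ => hd k).congr_of_eventuallyEq hphi
  have hdel : delLoc (fun x => cov ((dz j).comp (A x))) y =
      ∑ k, ∑ l, evalZ (fderiv ℝ (fun x => A x (vecE k) j) y) l •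
        (cov (dz l) * cov (dzbar k)) := by
    rw [localOp_del.congr hphi, localOp_sum localOp_del _ hd]
    refine Finset.sum_congr rfl fun k _ => ?_
    rw [delLoc_mul (hasFDerivAt_algebraMap (hc k)).differentiableAt (differentiableAt_const _),
      delLoc_const, mul_zero, add_zero, delLoc_algebraMap (hc k), Finset.sum_mul]
    exact Finset.sum_congr rfl fun l _ => smul_mul_assoc _ _ _
  have hdelbar : delbarLoc (fun x => cov ((dz j).comp (A x))) y =
      ∑ k, ∑ m, evalZbar (fderiv ℝ (fun x => A x (vecE k) j) y) m •
        (cov (dzbar m) * cov (dzbar k)) := by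
    rw [localOp_delbar.congr hphi, localOp_sum localOp_delbar _ hd]
    refine Finset.sum_congr rfl fun k _ => ?_
    rw [delbarLoc_mul_const (hasFDerivAt_algebraMap (hc k)).differentiableAt,
      delbarLoc_algebraMap (hc k), Finset.sum_mul]
    exact Finset.sum_congr rfl fun l _ => smul_mul_assoc _ _ _
  have hE : expContr (A y) (delLoc (fun x => cov ((dz j).comp (A x))) y) =
      delLoc (fun x => cov ((dz j).comp (A x))) y +
      ∑ k, ∑ m, (∑ l, A y (vecE m) l * evalZ (fderiv ℝ (fun x => A x (vecE k) j) y) l) •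
        (cov (dzbar m) * cov (dzbar k)) := by
    rw [hdel]
    simp only [map_sum, map_smul, map_mul, expContr_dz, expContr_dzbar, add_mul, smul_add,
      Finset.sum_add_distrib]
    congr 1
    refine Finset.sum_congr rfl fun k _ => ?_
    simp only [Finset.sum_smul]
    rw [Finset.sum_comm]
    refine Finset.sum_congr rfl fun l _ => ?_
    rw [dz_comp_eq hconj.self_of_nhds, cov, map_sum, Finset.sum_mul, Finset.smul_sum]
    refine Finset.sum_congr rfl fun m _ => ?_
    rw [map_smul, smul_mul_assoc, smul_smul, mul_comm]
  -- By the Maurer–Cartan equation the coefficients of `∂̄φ^j - i_φ ∂φ^j` are symmetric.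
  have hsymm := sum_antisymm (n := n) dzbar (fun m k => algebraMap ℂ (Lam n)
    (evalZbar (fderiv ℝ (fun x => A x (vecE k) j) y) m -
      ∑ l, A y (vecE m) l * evalZ (fderiv ℝ (fun x => A x (vecE k) j) y) l)) fun m k => by
    congr 1
    have h := hMC j m k
    rw [Finset.sum_sub_distrib] at h
    linear_combination h
  have hfin : ∑ k, ∑ m, evalZbar (fderiv ℝ (fun x => A x (vecE k) j) y) m •
        (cov (dzbar m) * cov (dzbar k)) =
      ∑ k, ∑ m, (∑ l, A y (vecE m) l * evalZ (fderiv ℝ (fun x => A x (vecE k) j) y) l) •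
        (cov (dzbar m) * cov (dzbar k)) := by
    rw [← sub_eq_zero, ← hsymm, Finset.sum_comm, Finset.sum_comm (f := fun k m =>
      (∑ l, A y (vecE m) l * evalZ (fderiv ℝ (fun x => A x (vecE k) j) y) l) •
        (cov (dzbar m) * cov (dzbar k)))]
    simp only [← Finset.sum_sub_distrib]
    refine Finset.sum_congr rfl fun m _ => Finset.sum_congr rfl fun k _ => ?_
    rw [← sub_smul, ← mul_assoc, ← Algebra.commutes, ← Algebra.smul_def]
  simp only [dPhiLoc, expContr_dz, contr_cov, tz_dz, dLoc_const, delLoc_const]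
  rw [localOp_d.add (differentiableAt_const _) hphid, dLoc_const, zero_add,
    ← map_zero (algebraMap ℂ (Lam n)), contr_algebraMap, sub_zero, map_zero, zero_add, hE, dLoc,
    hdelbar, hfin]

lemma conjAt_const (hA : DifferentiableAt ℝ A y)
    (hconj : ∀ᶠ x in nhds y, ∀ v, A x (Complex.I • v) = -(Complex.I • A x v))
    (hMC : MCAt A y) (x : Lam n) : ConjAt A y (fun _ => x) := by
  have hscalar : ∀ r : ℂ, ConjAt A y (fun _ => algebraMap ℂ (Lam n) r) := fun r =>
    conjAt_scalar hconj.self_of_nhds (differentiableAt_const r)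
  induction x using ExteriorAlgebra.induction with
  | algebraMap r => exact hscalar r
  | ι α =>
    have h : ∀ s : Finset (Fin n), ConjAt A y (fun _ => ∑ j ∈ s,
        (algebraMap ℂ (Lam n) (evalZ α j) * cov (dz j) +
          algebraMap ℂ (Lam n) (evalZbar α j) * cov (dzbar j))) := fun s => by
      classical
      induction s using Finset.induction_on with
      | empty => simpa using hscalar 0
      | insert i s hi h =>
        simp only [Finset.sum_insert hi]
        exact conjAt_add hA (conjAt_add hA
          (conjAt_mul hA (hscalar _) (conjAt_dz hA hconj hMC i))
          (conjAt_mul hA (hscalar _) (conjAt_dzbar i))) h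
    have h1 : cov α = ∑ j, (algebraMap ℂ (Lam n) (evalZ α j) * cov (dz j) +
          algebraMap ℂ (Lam n) (evalZbar α j) * cov (dzbar j)) := by
      conv_lhs => rw [cot_decomp α]
      simp only [cov, map_sum, map_add, map_smul, Algebra.smul_def]
    change ConjAt A y (fun _ => cov α)
    rw [h1]
    exact h Finset.univ
  | mul a b ha hb => exact conjAt_mul hA ha hb
  | add a b ha hb => exact conjAt_add hA ha hb

lemma conjAt_all (hA : DifferentiableAt ℝ A y)
    (hconj : ∀ᶠ x in nhds y, ∀ v, A x (Complex.I • v) = -(Complex.I • A x v))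
    (hMC : MCAt A y) {f : Cn n → Lam n} (hf : DifferentiableAt ℝ f y) : ConjAt A y f := by
  set b := Module.finBasis ℂ (Lam n)
  have h1 : f = fun x => ∑ i, algebraMap ℂ (Lam n) (b.repr (f x) i) * b i := by
    funext x
    conv_lhs => rw [← b.sum_repr (f x)]
    exact Finset.sum_congr rfl fun i _ => Algebra.smul_def _ _
  rw [h1]
  have h2 : ∀ i, ConjAt A y (fun x => algebraMap ℂ (Lam n) (b.repr (f x) i) * b i) := fun i =>
    conjAt_mul hA (conjAt_scalar hconj.self_of_nhds
      (((b.coord i).toContinuousLinearMap.restrictScalars ℝ).differentiableAt.comp _ hf))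
      (conjAt_const hA hconj hMC _)
  have h3 : ∀ s : Finset (Fin _),
      ConjAt A y (fun x => ∑ i ∈ s, algebraMap ℂ (Lam n) (b.repr (f x) i) * b i) := by
    intro s
    classical
    induction s using Finset.induction_on with
    | empty => simpa using conjAt_const hA hconj hMC (0 : Lam n)
    | insert i s hi h =>
      simp only [Finset.sum_insert hi]
      exact conjAt_add hA (h2 i) h
  exact h3 Finset.univ

/-! ### Properties of `∂` on `ℂⁿ` -/

lemma delLin_comp_clm (L : Cn n →L[ℝ] Cn n →L[ℝ] Lam n)
    (hL : ∀ v w, L v w = L w v) : delLin (delLinL.comp L) = 0 := by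
  have h : ∀ a, cov (dz a) * evalZ (delLinL.comp L) a =
      ∑ b, cov (dz a) * (cov (dz b) * evalZ (fun v => evalZ (L v) b) a) := fun a => by
    rw [← Finset.mul_sum]
    congr 1
    have h1 : ∀ v, (delLinL.comp L) v = ∑ b, cov (dz b) * evalZ (L v) b := fun v => rfl
    rw [evalZ, h1, h1, Finset.smul_sum, ← Finset.sum_sub_distrib, Finset.smul_sum]
    refine Finset.sum_congr rfl fun b _ => ?_
    rw [← mul_smul_comm, ← mul_sub, ← mul_smul_comm]
    rfl
  rw [delLin, Finset.sum_congr rfl fun a _ => h a]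
  refine sum_antisymm dz _ fun a b => ?_
  simp only [evalZ, hL (Complex.I • vecE b) (vecE a), hL (vecE b) (vecE a),
    hL (Complex.I • vecE b) (Complex.I • vecE a), hL (vecE b) (Complex.I • vecE a)]
  module

lemma delLoc_delLoc {f : Cn n → Lam n} {y : Cn n} (hf : ContDiffAt ℝ ∞ f y) :
    delLoc (delLoc f) y = 0 := by
  have h2 := (delLinL (n := n)).hasFDerivAt.comp y (differentiableAt_fderiv hf).hasFDerivAt
  have h3 : fderiv ℝ (delLoc f) y = _ := h2.fderiv
  rw [delLoc, h3]
  exact delLin_comp_clm _ (symm_fderiv hf)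

lemma delLoc_mem {f : Cn n → Lam n} {y : Cn n} {k : ℕ} (hf : DifferentiableAt ℝ f y)
    (h : ∀ᶠ x in nhds y, f x ∈ ⋀[ℂ]^k (Cot n)) : delLoc f y ∈ ⋀[ℂ]^(k + 1) (Cot n) := by
  have h1 : f =ᶠ[nhds y] fun x => realCLM (lamProj k) (f x) := by
    filter_upwards [h] with x hx using (lamProj_same hx).symm
  have h2 : fderiv ℝ f y = (realCLM (lamProj k)).comp (fderiv ℝ f y) := by
    conv_lhs => rw [h1.fderiv_eq]
    exact ((realCLM (lamProj k)).hasFDerivAt.comp y hf.hasFDerivAt).fderiv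
  have h3 : ∀ v, fderiv ℝ f y v ∈ ⋀[ℂ]^k (Cot n) := fun v => by
    rw [h2]; exact lamProj_mem k _
  rw [delLoc, delLin]
  exact Submodule.sum_mem _ fun a _ => cov_mul_mem _ <| Submodule.smul_mem _ _ <|
    Submodule.sub_mem _ (h3 _) (Submodule.smul_mem _ _ (h3 _))

/-! ### Rotation by `i` -/

lemma pull_mulI_dz (j : Fin n) : pull mulI (cov (dz j)) = Complex.I • cov (dz j) := by
  rw [pull_cov, ← map_smul]; congr 1

lemma pull_mulI_dzbar (j : Fin n) : pull mulI (cov (dzbar j)) = -(Complex.I • cov (dzbar j)) := by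
  rw [pull_cov, ← map_smul, ← map_neg]; congr 1; ext v; simp

lemma fderiv_pull_mulI {f : Cn n → Lam n} {y : Cn n} (hf : DifferentiableAt ℝ f y) :
    fderiv ℝ (fun x => pull mulI (f x)) y = (pullL mulI).comp (fderiv ℝ f y) :=
  ((pullL mulI).hasFDerivAt.comp y hf.hasFDerivAt).fderiv

lemma delLoc_pull_mulI {f : Cn n → Lam n} {y : Cn n} (hf : DifferentiableAt ℝ f y) :
    delLoc (fun x => pull mulI (f x)) y = -(Complex.I • pull mulI (delLoc f y)) := by
  simp only [delLoc, fderiv_pull_mulI hf, delLin, map_sum, Finset.smul_sum, map_mul,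
    pull_mulI_dz, ← Finset.sum_neg_distrib]
  refine Finset.sum_congr rfl fun j _ => ?_
  rw [smul_mul_assoc, smul_smul, Complex.I_mul_I, neg_one_smul, neg_neg]
  simp only [evalZ, ContinuousLinearMap.comp_apply, pullL_apply, map_smul, map_sub]

lemma delbarLoc_pull_mulI {f : Cn n → Lam n} {y : Cn n} (hf : DifferentiableAt ℝ f y) :
    delbarLoc (fun x => pull mulI (f x)) y = Complex.I • pull mulI (delbarLoc f y) := by
  simp only [delbarLoc, fderiv_pull_mulI hf, delbarLin, map_sum, Finset.smul_sum, map_mul,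
    pull_mulI_dzbar]
  refine Finset.sum_congr rfl fun j _ => ?_
  rw [neg_mul, smul_neg, smul_mul_assoc, smul_smul, Complex.I_mul_I, neg_one_smul, neg_neg]
  simp only [evalZbar, ContinuousLinearMap.comp_apply, pullL_apply, map_smul, map_add]

lemma contr_pull_mulI {A : Cn n →L[ℝ] Cn n} (hA : ∀ v, A (Complex.I • v) = -(Complex.I • A v))
    (x : Lam n) : contr A (pull mulI x) = -pull mulI (contr A x) := by
  have h : contr (-A) x = -contr A x := by
    rw [← contrL_apply, map_neg, neg_apply, contrL_apply]
  rw [contr_pull (A' := -A) (B := mulI) (fun v => rfl) (fun v => by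
    simp only [mulI_apply, neg_apply, hA, neg_neg]), h, map_neg]

lemma pull_mulI_four (x : Lam n) :
    pull mulI (pull mulI (pull mulI (pull mulI x))) = x := by
  rw [pull_pull, pull_pull, pull_pull]
  convert pull_id x
  ext1 v
  simp only [ContinuousLinearMap.comp_apply, mulI_apply, smul_smul, ContinuousLinearMap.id_apply]
  simp

/-- If `a` and `b` are transformed by `J` with the factors `-i` and `i`, then the `ab`-lemma for the
image of `a + b` gives it for the images of `a` and of `b`: if `ab y = 0`, then `a y + b y` and,
by the same argument for `J y`, also `-i a y + i b y` lie in the image of `ab`. -/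
lemma exists_of_rotation {V : Type*} [AddCommGroup V] [Module ℂ V] {a b J : V →ₗ[ℂ] V}
    (haa : ∀ x, a (a x) = 0) (hbb : ∀ x, b (b x) = 0) (hba : ∀ x, b (a x) = -a (b x))
    (haJ : ∀ x, a (J x) = -(Complex.I • J (a x))) (hbJ : ∀ x, b (J x) = Complex.I • J (b x))
    (hJ : ∀ x, J (J (J (J x))) = x)
    (H : LinearMap.ker a ⊓ LinearMap.ker b ⊓ LinearMap.range (a + b) = LinearMap.range (a ∘ₗ b))
    {y : V} (hy : a (b y) = 0) : (∃ w, a (b w) = a y) ∧ ∃ w, a (b w) = b y := by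
  have key : ∀ x, a (b x) = 0 → ∃ w, a (b w) = a x + b x := fun x hx => by
    have hmem : a x + b x ∈ LinearMap.range (a ∘ₗ b) := by
      rw [← H]
      refine ⟨⟨?_, ?_⟩, x, rfl⟩
      · rw [SetLike.mem_coe, LinearMap.mem_ker, map_add, haa, hx, add_zero]
      · rw [SetLike.mem_coe, LinearMap.mem_ker, map_add, hbb, hba, hx, neg_zero, add_zero]
    exact hmem
  have habJ : ∀ x, a (b (J x)) = J (a (b x)) := fun x => by
    rw [hbJ, map_smul, haJ, smul_neg, smul_smul, Complex.I_mul_I, neg_one_smul, neg_neg]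
  obtain ⟨w₁, h₁⟩ := key y hy
  obtain ⟨w₂, h₂⟩ := key (J y) (by rw [habJ, hy, map_zero])
  have h₃ : a (b (J (J (J w₂)))) = -(Complex.I • a y) + Complex.I • b y := by
    rw [habJ, habJ, habJ, h₂, haJ, hbJ]
    simp only [map_add, map_neg, map_smul, hJ]
  have hI : Complex.I * Complex.I = -1 := Complex.I_mul_I
  refine ⟨⟨(1 / 2 : ℂ) • (w₁ + Complex.I • J (J (J w₂))), ?_⟩,
    ⟨(1 / 2 : ℂ) • (w₁ - Complex.I • J (J (J w₂))), ?_⟩⟩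
  · simp only [map_smul, map_add, h₁, h₃, smul_add, smul_neg, smul_smul]
    match_scalars
    · linear_combination (-1 / 2 : ℂ) * hI
    · linear_combination (1 / 2 : ℂ) * hI
  · simp only [map_smul, map_sub, h₁, h₃, smul_add, smul_neg, smul_smul]
    match_scalars
    · linear_combination (1 / 2 : ℂ) * hI
    · linear_combination (-1 / 2 : ℂ) * hI

/-! ### Operators on the forms on a complex manifold -/

section manifold

variable {X : Type u} [TopologicalSpace X] [ChartedSpace (Cn n) X] [IsManifold 𝓘(ℂ, Cn n) ω X]

variable (n X) in
/-- The operator on forms that is multiplication by `i^(p-q)` on forms of type `(p,q)`: the pullback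
along multiplication by `i` on the tangent spaces. -/
def rot : Forms n X →ₗ[ℂ] Forms n X where
  toFun w := ⟨fun e y => pull mulI (w.1 e y),
    fun e => smooth_congr ((pullL mulI).contDiff.comp_contDiffOn (w.2.smooth e)) fun y => by
      change _ = pull mulI (extend e.1.target (w.1 e) y)
      rw [extend_coe],
    fun e e' y hy => by
      rw [w.2.compat e e' y hy, pull_pull, pull_pull]
      congr 2
      ext1 v
      exact (transition_hol e e' y.2 hy).self_of_nhds v⟩
  map_add' _ _ := Subtype.ext <| funext fun _ => funext fun _ => map_add _ _ _
  map_smul' c _ := Subtype.ext <| funext fun _ => funext fun _ => map_smul (pull mulI) c _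

lemma rot_four (w : Forms n X) : rot n X (rot n X (rot n X (rot n X w))) = w :=
  Subtype.ext <| funext fun _ => funext fun _ => pull_mulI_four _

lemma extend_rot (w : Forms n X) (e : atlas (Cn n) X) (y : e.1.target) :
    extend e.1.target ((rot n X w).1 e) =ᶠ[nhds (y : Cn n)]
      fun x => pull mulI (extend e.1.target (w.1 e) x) := by
  filter_upwards [e.1.open_target.mem_nhds y.2] with x hx
  rw [extend_of_mem _ hx, extend_of_mem _ hx]; rfl

lemma del_rot (w : Forms n X) :
    del n X (rot n X w) = -(Complex.I • rot n X (del n X w)) :=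
  Subtype.ext <| funext fun e => funext fun y =>
    (localOp_del.congr (extend_rot w e y)).trans (delLoc_pull_mulI (extend_diff w.2 e y.2))

lemma delbar_rot (w : Forms n X) :
    delbar n X (rot n X w) = Complex.I • rot n X (delbar n X w) :=
  Subtype.ext <| funext fun e => funext fun y =>
    (localOp_delbar.congr (extend_rot w e y)).trans (delbarLoc_pull_mulI (extend_diff w.2 e y.2))

lemma extD_eq (w : Forms n X) : extD n X w = del n X w + delbar n X w := rfl

lemma del_del (w : Forms n X) : del n X (del n X w) = 0 := by
  refine Subtype.ext <| funext fun e => funext fun y => ?_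
  have h : extend e.1.target ((del n X w).1 e) =ᶠ[nhds (y : Cn n)]
      delLoc (extend e.1.target (w.1 e)) := by
    filter_upwards [e.1.open_target.mem_nhds y.2] with x hx
    rw [extend_of_mem _ hx]; rfl
  exact (localOp_del.congr h).trans (delLoc_delLoc (extend_smoothAt w.2 e y.2))

/-- From `d² = 0` and `∂² = 0` one has `∂∂̄ + ∂̄∂ = -∂̄²`; rotation fixes the left-hand side and
changes the sign of the right-hand side, so that both vanish. -/
lemma delbar_del (w : Forms n X) :
    delbar n X (del n X w) = -del n X (delbar n X w) := by
  have h : ∀ w, delbar n X (del n X w) + del n X (delbar n X w) +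
      delbar n X (delbar n X w) = 0 := fun w => by
    have := extD_extD w
    rw [extD_eq, extD_eq, map_add, map_add, del_del, zero_add] at this
    rw [← this]; abel
  have h1 := congrArg (fun z => rot n X (rot n X (rot n X z))) (h (rot n X w))
  simp only [del_rot, delbar_rot, map_neg, map_smul, smul_neg, smul_smul, Complex.I_mul_I,
    map_add, rot_four, map_zero, neg_smul, one_smul, neg_neg] at h1
  have h2 : (2 : ℂ) • (delbar n X (del n X w) + del n X (delbar n X w)) = 0 := by
    rw [two_smul]
    nth_rewrite 1 [eq_neg_of_add_eq_zero_left (h w)]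
    rw [← h1]; abel
  exact eq_neg_of_add_eq_zero_left ((smul_eq_zero.mp h2).resolve_left two_ne_zero)

lemma del_mem {k : ℕ} {w : Forms n X} (hw : w ∈ formGrading n X k) :
    del n X w ∈ formGrading n X (k + 1) := fun e y => by
  refine delLoc_mem (extend_diff w.2 e y.2) ?_
  filter_upwards [e.1.open_target.mem_nhds y.2] with x hx
  rw [extend_of_mem _ hx]
  exact hw e _

lemma del_mul {k : ℕ} {a : Forms n X} (ha : a ∈ formGrading n X k) (b : Forms n X) :
    del n X (a * b) = del n X a * b + (-1 : ℂ) ^ k • (a * del n X b) := by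
  refine Subtype.ext <| funext fun e => funext fun y => ?_
  have h : extend e.1.target ((a * b).1 e) =ᶠ[nhds (y : Cn n)]
      fun x => extend e.1.target (a.1 e) x * extend e.1.target (b.1 e) x := by
    filter_upwards [e.1.open_target.mem_nhds y.2] with x hx
    rw [extend_of_mem _ hx, extend_of_mem _ hx, extend_of_mem _ hx]; rfl
  refine (localOp_del.congr h).trans ?_
  rw [delLoc_mul (extend_diff a.2 e y.2) (extend_diff b.2 e y.2), extend_coe, extend_coe,
    inv_of_mem (ha e y), smul_mul_assoc]
  rfl

namespace Beltrami

variable (φ : Beltrami n X)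

lemma contraction_rot (w : Forms n X) :
    φ.contraction (rot n X w) = -rot n X (φ.contraction w) :=
  Subtype.ext <| funext fun e => funext fun y => contr_pull_mulI (φ.conj_linear e y y.2) _

lemma lie_apply (w : Forms n X) :
    φ.lie w = φ.contraction (del n X w) - del n X (φ.contraction w) := rfl

lemma delbarPhi_apply (w : Forms n X) : φ.delbarPhi w = delbar n X w - φ.lie w := rfl

lemma dPhi_apply (w : Forms n X) : φ.dPhi w = del n X w + φ.delbarPhi w := rfl

lemma delbarPhi_rot (w : Forms n X) :
    φ.delbarPhi (rot n X w) = Complex.I • rot n X (φ.delbarPhi w) := by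
  simp only [delbarPhi_apply, lie_apply, delbar_rot, del_rot, contraction_rot, map_neg, map_smul,
    map_sub, smul_sub, smul_neg, neg_neg]

lemma delbarPhi_del (w : Forms n X) : φ.delbarPhi (del n X w) = -del n X (φ.delbarPhi w) := by
  simp only [delbarPhi_apply, lie_apply, delbar_del, del_del, map_sub, map_zero]
  abel

/-- The algebra automorphism `e^{i_φ}` of `A^•(X)`. -/
def expForm : Forms n X →ₐ[ℂ] Forms n X where
  toFun w := ⟨fun e y => expContr (φ.toFun e y) (w.1 e y), by
    refine ⟨fun e => smooth_congr (contDiff_expContr.comp_contDiffOn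
      ((φ.smooth e).prodMk (w.2.smooth e))) fun y => ?_, fun e e' y hy => ?_⟩
    · change _ = expContr _ (extend _ _ _)
      rw [extend_coe]
    · rw [w.2.compat e e' y hy]
      exact expContr_pull (transition_hol e e' y.2 hy).self_of_nhds (φ.compat e e' y y.2 hy) _⟩
  map_one' := Subtype.ext <| funext fun _ => funext fun _ => map_one _
  map_mul' _ _ := Subtype.ext <| funext fun _ => funext fun _ => map_mul _ _ _
  map_zero' := Subtype.ext <| funext fun _ => funext fun _ => map_zero _
  map_add' _ _ := Subtype.ext <| funext fun _ => funext fun _ => map_add _ _ _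
  commutes' r := Subtype.ext <| funext fun _ => funext fun _ => AlgHom.commutes _ r

lemma expForm_mem {k : ℕ} {w : Forms n X} (hw : w ∈ formGrading n X k) :
    φ.expForm w ∈ formGrading n X k := fun e y => expContr_mem _ (hw e y)

/-- The Beltrami differential `-φ`. -/
def neg : Beltrami n X where
  toFun e y := -φ.toFun e y
  smooth e := (φ.smooth e).neg
  conj_linear e y hy v := by rw [neg_apply, neg_apply, φ.conj_linear e y hy, smul_neg]
  compat e e' y hy hy' v := by rw [neg_apply, neg_apply, φ.compat e e' y hy hy', map_neg]

lemma expForm_neg (w : Forms n X) : φ.neg.expForm (φ.expForm w) = w :=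
  Subtype.ext <| funext fun e => funext fun y => expContr_neg (φ.conj_linear e y y.2) _

lemma expForm_neg' (w : Forms n X) : φ.expForm (φ.neg.expForm w) = w :=
  Subtype.ext <| funext fun e => funext fun y => expContr_neg' (φ.conj_linear e y y.2) _

lemma expForm_bijective : Function.Bijective φ.expForm :=
  Function.bijective_iff_has_inverse.mpr ⟨φ.neg.expForm, φ.expForm_neg, φ.expForm_neg'⟩

lemma dPhi_coe (w : Forms n X) (e : atlas (Cn n) X) (y : e.1.target) :
    (φ.dPhi w).1 e y = dPhiLoc (φ.toFun e) (extend e.1.target (w.1 e)) y := by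
  have h : extend e.1.target ((φ.contraction w).1 e) =ᶠ[nhds (y : Cn n)]
      fun x => contr (φ.toFun e x) (extend e.1.target (w.1 e) x) := by
    filter_upwards [e.1.open_target.mem_nhds y.2] with x hx
    rw [extend_of_mem _ hx, extend_of_mem _ hx]; rfl
  rw [dPhiLoc, ← localOp_del.congr h, dLoc]
  change delLoc (extend e.1.target (w.1 e)) y + (delbarLoc (extend e.1.target (w.1 e)) y -
    (contr (φ.toFun e y) (delLoc (extend e.1.target (w.1 e)) y) -
      delLoc (extend e.1.target ((φ.contraction w).1 e)) y)) = _
  abel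

variable {φ}

/-- The Maurer–Cartan equation says that `e^{i_φ}` conjugates `d` into `d_φ`. -/
lemma extD_expForm (hφ : φ.MaurerCartan) (w : Forms n X) :
    extD n X (φ.expForm w) = φ.expForm (φ.dPhi w) := by
  refine Subtype.ext <| funext fun e => funext fun y => ?_
  have h : extend e.1.target ((φ.expForm w).1 e) =ᶠ[nhds (y : Cn n)]
      fun x => expContr (φ.toFun e x) (extend e.1.target (w.1 e) x) := by
    filter_upwards [e.1.open_target.mem_nhds y.2] with x hx
    rw [extend_of_mem _ hx, extend_of_mem _ hx]; rfl
  have hA : DifferentiableAt ℝ (φ.toFun e) y :=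
    ((φ.smooth e).contDiffAt (e.1.open_target.mem_nhds y.2)).differentiableAt (by simp)
  have hconj : ∀ᶠ x in nhds (y : Cn n), ∀ v,
      φ.toFun e x (Complex.I • v) = -(Complex.I • φ.toFun e x v) := by
    filter_upwards [e.1.open_target.mem_nhds y.2] with x hx using φ.conj_linear e x hx
  refine (dLoc_congr h).trans
    ((conjAt_all hA hconj (hφ e y y.2) (extend_diff w.2 e y.2)).2.trans ?_)
  rw [← dPhi_coe]
  rfl

lemma dPhi_eq (hφ : φ.MaurerCartan) (w : Forms n X) :
    φ.dPhi w = φ.neg.expForm (extD n X (φ.expForm w)) := by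
  rw [extD_expForm hφ, expForm_neg]

lemma dPhi_dPhi (hφ : φ.MaurerCartan) (w : Forms n X) : φ.dPhi (φ.dPhi w) = 0 := by
  rw [dPhi_eq hφ, ← extD_expForm hφ, extD_extD, map_zero]

lemma delbarPhi_delbarPhi (hφ : φ.MaurerCartan) (w : Forms n X) :
    φ.delbarPhi (φ.delbarPhi w) = 0 := by
  have h := dPhi_dPhi hφ w
  rw [dPhi_apply, dPhi_apply, map_add, map_add, del_del, delbarPhi_del, zero_add] at h
  rwa [add_neg_cancel_left] at h

/-- The differential graded algebra `(A^•(X), d_φ)`. -/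
abbrev dga (hφ : φ.MaurerCartan) : DGA.{u} where
  carrier := Forms n X
  grading := formGrading n X
  d := φ.dPhi
  d_mem hw := by
    rw [dPhi_eq hφ]
    exact φ.neg.expForm_mem (extD_mem (φ.expForm_mem hw))
  d_d := dPhi_dPhi hφ
  leibniz ha b := by
    rw [dPhi_eq hφ, map_mul, extD_mul (φ.expForm_mem ha), map_add, map_smul, map_mul, map_mul,
      ← dPhi_eq hφ, ← dPhi_eq hφ, expForm_neg, expForm_neg]
  comm ha hb := (deRham n X).comm ha hb

/-- The isomorphism `e^{i_φ}` from `(A^•(X), d_φ)` to the de Rham algebra. -/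
def dgaHom (hφ : φ.MaurerCartan) : DGA.Hom (dga hφ) (deRham n X) where
  toAlgHom := φ.expForm
  map_mem := φ.expForm_mem
  map_d w := (extD_expForm hφ w).symm

/-- The operator `∂`, as a second differential on `(A^•(X), d_φ)`. -/
abbrev delDifferential (hφ : φ.MaurerCartan) : DGA.SecondDifferential (dga hφ) where
  δ := del n X
  δ_mem := del_mem
  δ_δ := del_del
  leibniz := del_mul
  anticomm w := by
    change φ.dPhi (del n X w) = -del n X (φ.dPhi w)
    rw [dPhi_apply, dPhi_apply, map_add, del_del, delbarPhi_del, zero_add, zero_add]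

lemma delDifferential_lemma (hφ : φ.MaurerCartan) (h : φ.DelDelbarLemma) :
    (delDifferential hφ).DDeltaLemma := by
  have hd : ∀ w, del n X (φ.dPhi w) = del n X (φ.delbarPhi w) := fun w => by
    rw [dPhi_apply, map_add, del_del, zero_add]
  have key : ∀ y, del n X (φ.delbarPhi y) = 0 →
      (∃ w, del n X (φ.delbarPhi w) = del n X y) ∧
        ∃ w, del n X (φ.delbarPhi w) = φ.delbarPhi y := fun y hy =>
    exists_of_rotation del_del (delbarPhi_delbarPhi hφ) φ.delbarPhi_del del_rot φ.delbarPhi_rot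
      rot_four h hy
  constructor
  · intro y hy
    have hy : φ.dPhi (del n X y) = 0 := hy
    rw [dPhi_apply, del_del, zero_add, delbarPhi_del, neg_eq_zero] at hy
    obtain ⟨w, hw⟩ := (key y hy).1
    exact ⟨w, (hd w).trans hw⟩
  · intro y hy
    have hy : del n X (φ.delbarPhi y) = 0 := (hd y).symm.trans hy
    obtain ⟨⟨w, hw⟩, v, hv⟩ := key y hy
    exact ⟨w + v, (hd _).trans (by rw [map_add, map_add, hw, hv, dPhi_apply])⟩

end Beltrami

end manifold

end DeformedForms

end

theorem mainTheorem3 {n : ℕ} {X : Type*} [TopologicalSpace X] [T2Space X] [CompactSpace X]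
    [ChartedSpace (EuclideanSpace ℂ (Fin n)) X]
    [IsManifold 𝓘(ℂ, EuclideanSpace ℂ (Fin n)) ω X]
    (φ : DeformedForms.Beltrami n X) (hφ : φ.MaurerCartan) (h : φ.DelDelbarLemma) :
    (DeformedForms.deRham n X).IsFormal :=
  (DeformedForms.Beltrami.delDifferential_lemma hφ h).isFormal.of_eqvGen <|
    .rel _ _ ⟨DeformedForms.Beltrami.dgaHom hφ,
      DeformedForms.DGA.Hom.isQuasiIso_of_bijective _ φ.expForm_bijective⟩
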